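/- Let $n\ge 2$. Denote by $|\cdot|$ the Lebesgue measure on $\mathbb R^n$, by $B(x,r)$ the open Euclidean ball of center $x$ and radius $r$, and let $B:=B(0,1)$. For $s\in(0,1)$ and a Lebesgue measurable set $E\subset\mathbb R^n$ let $$P_s(E):=\int_E\int_{E^c}\frac{dx\,dy}{|x-y|^{n+s}}\in[0,\infty]$$ be the $s$-perimeter of $E$, let $$P(E):=\sup\Big\{\int_E {\rm div}\,X\,dx : X\in C^1_c(\mathbb R^n;\mathbb R^n),\ |X|\le 1\Big\}$$ be its (distributional) perimeter, and let $E^{(1)}$ be the set of points of density $1$ of $E$, that is, of those $x\in\mathbb R^n$ with $|E\cap B(x,r)|/|B(x,r)|\to 1$ as $r\to 0^+$. Let $\xi(n)$ be Besicovitch's covering constant, that is, the least $N\in\mathbb N$ such that every family of closed balls in $\mathbb R^n$ with positive, uniformly bounded radii has $N$ countable (possibly empty) subfamilies, each consisting of pairwise disjoint balls, which together cover the set of all centers of the family. For $s\in(0,1)$ set $$\chi_1(n,s):=\frac{(1-s)\,P_s(B)}{4\,|B|^{(n-s)/n}\,\xi(n)}\,,\qquad \chi_2(n,s):=\frac{2^{3+(n/s)}\,|B|^{(n-s)/n}\,P(B)}{s\,(1-s)\,P_s(B)}\,.$$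 If $s\in(0,1)$ and $E\subset\mathbb R^n$ is a Lebesgue measurable set with $P_s(E)<\infty$ and $0<|E|<\infty$, then there exists $x\in E^{(1)}$ such that $$|E\cap B(x,1)|\ge\min\Big\{\frac{\chi_1(n,s)\,|E|}{(1-s)\,P_s(E)},\frac{1}{\chi_2(n,s)}\Big\}^{n/s}.$$ Moreover, for every $s_0\in(0,1)$, $$0<\inf\big\{\chi_1(n,s),\ \chi_2(n,s)^{-1} : s\in[s_0,1)\big\}<\infty .$$ -/

import Mathlib

open MeasureTheory Set Filter Topology

noncomputable section

/-- The `s`-perimeter `P_s(E) = ∫_E ∫_{Eᶜ} |x - y|^{-(n+s)} dy dx ∈ [0, ∞]` of `E ⊆ ℝⁿ`. -/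
def sPerimeter {n : ℕ} (s : ℝ) (E : Set (EuclideanSpace ℝ (Fin n))) : ENNReal :=
  ∫⁻ x in E, ∫⁻ y in Eᶜ, ENNReal.ofReal (1 / ‖x - y‖ ^ ((n : ℝ) + s))

/-- The divergence of a vector field on `ℝⁿ`. -/
def vdiv {n : ℕ} (X : EuclideanSpace ℝ (Fin n) → EuclideanSpace ℝ (Fin n))
    (x : EuclideanSpace ℝ (Fin n)) : ℝ :=
  ∑ i : Fin n, (fderiv ℝ X x (EuclideanSpace.single i 1)) i

/-- The distributional perimeter
`P(E) = sup {∫_E div X : X ∈ C¹_c(ℝⁿ; ℝⁿ), |X| ≤ 1} ∈ [0, ∞]`. (The zero field competes, so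
truncating negative integrals to `0` does not change the supremum.) -/
def perimeter {n : ℕ} (E : Set (EuclideanSpace ℝ (Fin n))) : ENNReal :=
  ⨆ (X : EuclideanSpace ℝ (Fin n) → EuclideanSpace ℝ (Fin n))
    (_ : ContDiff ℝ 1 X ∧ HasCompactSupport X ∧ ∀ x, ‖X x‖ ≤ 1),
    ENNReal.ofReal (∫ x in E, vdiv X x)

/-- The set `E^{(1)}` of points of density `1` of `E`. -/
def densityOnePoints {n : ℕ} (E : Set (EuclideanSpace ℝ (Fin n))) :
    Set (EuclideanSpace ℝ (Fin n)) :=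
  {x | Tendsto (fun r : ℝ => volume (E ∩ Metric.ball x r) / volume (Metric.ball x r))
    (𝓝[>] 0) (𝓝 1)}

/-- `N` is admissible in Besicovitch's covering theorem in `ℝⁿ`: from every family of closed
balls of positive and bounded radii (given by their centre and radius) one can extract `N`
countable subfamilies of pairwise disjoint balls which together cover all the centres. -/
def IsBesicovitchConst (n N : ℕ) : Prop :=
  ∀ F : Set (EuclideanSpace ℝ (Fin n) × ℝ), (∀ p ∈ F, 0 < p.2) → BddAbove (Prod.snd '' F) →
    ∃ G : Fin N → Set (EuclideanSpace ℝ (Fin n) × ℝ),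
      (∀ i, G i ⊆ F ∧ (G i).Countable ∧
        (G i).PairwiseDisjoint fun p => Metric.closedBall p.1 p.2) ∧
      Prod.fst '' F ⊆ ⋃ i, ⋃ p ∈ G i, Metric.closedBall p.1 p.2

/-- Besicovitch's covering constant `ξ(n)`: the least admissible number of subfamilies. -/
def besicovitchConst (n : ℕ) : ℕ := sInf {N : ℕ | IsBesicovitchConst n N}

theorem exists_isBesicovitchConst (n : ℕ) : ∃ N, IsBesicovitchConst n N := by
  obtain ⟨N, τ, hτ, hN⟩ := HasBesicovitchCovering.no_satelliteConfig
    (α := EuclideanSpace ℝ (Fin n))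
  refine ⟨N, fun F hpos hbdd => ?_⟩
  obtain ⟨R, hR⟩ := hbdd
  let q : Besicovitch.BallPackage F (EuclideanSpace ℝ (Fin n)) :=
    { c := fun p => p.1.1
      r := fun p => p.1.2
      rpos := fun p => hpos p.1 p.2
      r_bound := R
      r_le := fun p => hR ⟨p.1, p.2, rfl⟩ }
  obtain ⟨t, ht, hc⟩ := Besicovitch.exist_disjoint_covering_families hτ hN q
  refine ⟨fun i => Subtype.val '' t i, fun i => ⟨?_, ?_, ?_⟩, ?_⟩
  · rintro _ ⟨p, _, rfl⟩
    exact p.2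
  · refine Countable.image ?_ _
    refine (ht i).countable_of_nonempty_interior fun p _ => ?_
    exact ⟨q.c p, Metric.ball_subset_interior_closedBall (Metric.mem_ball_self (q.rpos p))⟩
  · rintro _ ⟨p, hp, rfl⟩ _ ⟨p', hp', rfl⟩ hne
    exact ht i hp hp' fun h => hne (congrArg _ h)
  · rintro _ ⟨p, hp, rfl⟩
    have h := hc ⟨⟨p, hp⟩, rfl⟩
    simp only [mem_iUnion] at h ⊢
    obtain ⟨i, j, hj, hx⟩ := h
    exact ⟨i, j.1, ⟨j, hj, rfl⟩, Metric.ball_subset_closedBall hx⟩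

theorem isBesicovitchConst_besicovitchConst (n : ℕ) :
    IsBesicovitchConst n (besicovitchConst n) :=
  Nat.sInf_mem (exists_isBesicovitchConst n)

/-- The open unit ball `B` of `ℝⁿ`. -/
def unitBall (n : ℕ) : Set (EuclideanSpace ℝ (Fin n)) := Metric.ball 0 1

/-- `χ₁(n,s) = (1-s) P_s(B) / (4 |B|^{(n-s)/n} ξ(n))`. -/
def chi₁ (n : ℕ) (s : ℝ) : ℝ :=
  (1 - s) * (sPerimeter s (unitBall n)).toReal /
    (4 * (volume (unitBall n)).toReal ^ (((n : ℝ) - s) / n) * besicovitchConst n)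

/-- `χ₂(n,s) = 2^{3+n/s} |B|^{(n-s)/n} P(B) / (s (1-s) P_s(B))`. -/
def chi₂ (n : ℕ) (s : ℝ) : ℝ :=
  (2 : ℝ) ^ (3 + (n : ℝ) / s) * (volume (unitBall n)).toReal ^ (((n : ℝ) - s) / n) *
    (perimeter (unitBall n)).toReal / (s * (1 - s) * (sPerimeter s (unitBall n)).toReal)

end

noncomputable section

/-! The lower bound on `|E ∩ B(x,1)|` comes from averaging over translated balls, not from a
covering argument. Write `m` for the minimum in the statement and suppose every density-one point
`z` has `|E ∩ B(z,1)| < m^(n/s)`. A ball `B(x,1/2)` meeting `E` in positive measure contains such a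
`z` and lies in `B(z,1)`, so `|E ∩ B(x,1/2)| ≤ m^(n/s)` for all `x`. On sets this small the
fractional isoperimetric inequality becomes linear, `P_s(F) ≥ K |F|` with `K` proportional to `1/m`.
Take `F = E ∩ B(x,1/2)` and integrate in `x`. By Fubini, `K |B_{1/2}| |E| ≤ ∫ P_s(E ∩ B(x,1/2)) dx ≤
|B_{1/2}| P_s(E) + |E| P_s(B_{1/2})`. The definition of `m` bounds `m P_s(E)` through `χ₁` and `m`
itself through `χ₂`; with explicit constants the two sides then contradict each other.

Everything rests on `P_s(F) = ∫ |h|^(-n-s) |F \ (F+h)| dh`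
(`sPerimeter_eq_lintegral_translateDiff`). It yields the isoperimetric inequality
(`le_sPerimeter_of_volume_eq`), the upper bound for balls (`lintegral_translateDiff_ball_le`) and
the averaged estimate (`lintegral_sPerimeter_inter_translate_le`). Of `ξ(n)` and `P(B)` the
contradiction uses only lower bounds, `ξ(n) ≥ 2n` and `P(B) ≥ (4/5) n |B|`, together with `P(B) <
∞`. The uniformity in `s ≥ s₀` follows from the lower bound on `(1-s) P_s(B)`. -/

/-! ### Polar coordinates and integrals of the kernel -/

theorem lintegral_fun_norm_eq_mul_lintegral_Ioi {E : Type*} [NormedAddCommGroup E]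
    [NormedSpace ℝ E] [MeasurableSpace E] [BorelSpace E] [FiniteDimensional ℝ E] [Nontrivial E]
    (μ : Measure E) [μ.IsAddHaarMeasure] {f : ℝ → ENNReal} (hf : Measurable f) :
    ∫⁻ x, f ‖x‖ ∂μ = Module.finrank ℝ E * μ (Metric.ball 0 1) *
      ∫⁻ y in Ioi (0 : ℝ), ENNReal.ofReal (y ^ (Module.finrank ℝ E - 1)) * f y := by
  have hf' : Measurable fun x : Ioi (0 : ℝ) => f x := hf.comp measurable_subtype_coe
  calc
    ∫⁻ x, f ‖x‖ ∂μ = ∫⁻ x : ({(0)}ᶜ : Set E), f ‖x.1‖ ∂(μ.comap (↑)) := by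
      rw [lintegral_subtype_comap (measurableSet_singleton _).compl fun x ↦ f ‖x‖,
        restrict_compl_singleton]
    _ = ∫⁻ x, f x.2 ∂μ.toSphere.prod (.volumeIoiPow (Module.finrank ℝ E - 1)) := by
      simpa using μ.measurePreserving_homeomorphUnitSphereProd.lintegral_comp
        (f := fun x => f x.2) (hf'.comp measurable_snd)
    _ = μ.toSphere univ *
        ∫⁻ x : Ioi (0 : ℝ), f x ∂.volumeIoiPow (Module.finrank ℝ E - 1) := by
      have h := lintegral_prod (μ := μ.toSphere) (ν := .volumeIoiPow (Module.finrank ℝ E - 1))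
        (fun x => f x.2) (hf'.comp measurable_snd).aemeasurable
      rw [h, mul_comm]
      exact lintegral_const (∫⁻ x : Ioi (0 : ℝ), f x ∂.volumeIoiPow (Module.finrank ℝ E - 1))
    _ = _ := by
      rw [μ.toSphere_apply_univ, Measure.volumeIoiPow, lintegral_withDensity_eq_lintegral_mul _
        (by fun_prop) hf']
      congr 1
      exact lintegral_subtype_comap measurableSet_Ioi
        fun y => ENNReal.ofReal (y ^ (Module.finrank ℝ E - 1)) * f y

/-- The kernel `|h|^{-(n+s)}` of the `s`-perimeter. -/
def perimeterKernel (n : ℕ) (s : ℝ) (h : EuclideanSpace ℝ (Fin n)) : ENNReal :=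
  ENNReal.ofReal (1 / ‖h‖ ^ ((n : ℝ) + s))

/-- The measure of `F \ (F + h)`. -/
def translateDiff {n : ℕ} (F : Set (EuclideanSpace ℝ (Fin n))) (h : EuclideanSpace ℝ (Fin n)) :
    ENNReal :=
  volume (F ∩ {x | x - h ∉ F})

/-- The volume of the unit ball of `ℝⁿ`, as a real number. -/
def ballVolume (n : ℕ) : ℝ := (volume (unitBall n)).toReal

variable {n : ℕ}

@[fun_prop]
theorem measurable_perimeterKernel (s : ℝ) : Measurable (perimeterKernel n s) := by
  unfold perimeterKernel
  fun_prop

theorem ballVolume_pos : 0 < ballVolume n :=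
  ENNReal.toReal_pos (Metric.measure_ball_pos _ _ one_pos).ne' measure_ball_lt_top.ne

theorem volume_unitBall : volume (unitBall n) = ENNReal.ofReal (ballVolume n) :=
  (ENNReal.ofReal_toReal measure_ball_lt_top.ne).symm

theorem volume_ball_eq (hn : 2 ≤ n) (x : EuclideanSpace ℝ (Fin n)) {r : ℝ} (hr : 0 ≤ r) :
    volume (Metric.ball x r) = ENNReal.ofReal (ballVolume n * r ^ n) := by
  have : Nonempty (Fin n) := ⟨⟨0, by omega⟩⟩
  rw [Measure.addHaar_ball _ _ hr, finrank_euclideanSpace_fin, ENNReal.ofReal_mul ballVolume_pos.le,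
    ← volume_unitBall, mul_comm]
  rfl

theorem lintegral_norm_comp (hn : 2 ≤ n) {f : ℝ → ENNReal} (hf : Measurable f) :
    ∫⁻ x : EuclideanSpace ℝ (Fin n), f ‖x‖ = ENNReal.ofReal (n * ballVolume n) *
      ∫⁻ y in Ioi (0 : ℝ), ENNReal.ofReal (y ^ (n - 1)) * f y := by
  have : Nonempty (Fin n) := ⟨⟨0, by omega⟩⟩
  rw [lintegral_fun_norm_eq_mul_lintegral_Ioi _ hf, finrank_euclideanSpace_fin,
    ENNReal.ofReal_mul (by positivity), ENNReal.ofReal_natCast, ← volume_unitBall]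
  rfl

theorem pow_pred_mul_rpow_neg (hn : 2 ≤ n) (s : ℝ) {y : ℝ} (hy : 0 < y) :
    y ^ (n - 1) * (1 / y ^ ((n : ℝ) + s)) = y ^ (-1 - s) := by
  rw [one_div, ← Real.rpow_neg hy.le, ← Real.rpow_natCast, ← Real.rpow_add hy]
  congr 1
  push_cast [Nat.cast_sub (show 1 ≤ n by omega)]
  ring

theorem lintegral_perimeterKernel_exterior (hn : 2 ≤ n) {s a : ℝ} (hs : 0 < s) (ha : 0 < a) :
    ∫⁻ h in {h : EuclideanSpace ℝ (Fin n) | a < ‖h‖}, perimeterKernel n s h =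
      ENNReal.ofReal (n * ballVolume n * a ^ (-s) / s) := by
  have hm : MeasurableSet {h : EuclideanSpace ℝ (Fin n) | a < ‖h‖} :=
    measurableSet_lt measurable_const measurable_norm
  have hk : ∫⁻ y in Ioi a, ENNReal.ofReal (y ^ (-1 - s)) = ENNReal.ofReal (a ^ (-s) / s) := by
    rw [← ofReal_integral_eq_lintegral_ofReal (integrableOn_Ioi_rpow_of_lt (by linarith) ha),
      integral_Ioi_rpow_of_lt (by linarith) ha]
    · congr 1
      rw [show -1 - s + 1 = -s by ring, neg_div_neg_eq]
    · filter_upwards [ae_restrict_mem measurableSet_Ioi] with y hy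
      exact Real.rpow_nonneg (ha.trans hy).le _
  rw [mul_div_assoc, ENNReal.ofReal_mul (mul_nonneg n.cast_nonneg ballVolume_pos.le), ← hk,
    ← lintegral_indicator hm, ← lintegral_indicator measurableSet_Ioi]
  have := lintegral_norm_comp hn (f := (Ioi a).indicator
    fun y => ENNReal.ofReal (1 / y ^ ((n : ℝ) + s)))
    (Measurable.indicator (by fun_prop) measurableSet_Ioi)
  refine Eq.trans ?_ (this.trans ?_)
  · rfl
  · rw [← lintegral_indicator measurableSet_Ioi]
    congr 2
    ext y
    by_cases hy : a < y
    · have hy0 := ha.trans hy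
      simp only [indicator, mem_Ioi, hy, hy0, if_true]
      rw [← ENNReal.ofReal_mul (by positivity), pow_pred_mul_rpow_neg hn s hy0]
    · simp [indicator, hy]

theorem lintegral_perimeterKernel_mul_norm_interior (hn : 2 ≤ n) {s a : ℝ} (hs : s < 1)
    (ha : 0 < a) :
    ∫⁻ h in {h : EuclideanSpace ℝ (Fin n) | ‖h‖ ≤ a},
        perimeterKernel n s h * ENNReal.ofReal ‖h‖ =
      ENNReal.ofReal (n * ballVolume n * a ^ (1 - s) / (1 - s)) := by
  have hm : MeasurableSet {h : EuclideanSpace ℝ (Fin n) | ‖h‖ ≤ a} :=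
    measurableSet_le measurable_norm measurable_const
  have hk : ∫⁻ y in Ioc 0 a, ENNReal.ofReal (y ^ (-s)) =
      ENNReal.ofReal (a ^ (1 - s) / (1 - s)) := by
    have hi := (intervalIntegral.intervalIntegrable_rpow' (a := 0) (b := a)
      (show -1 < -s by linarith)).1
    rw [← ofReal_integral_eq_lintegral_ofReal hi, ← intervalIntegral.integral_of_le ha.le,
      integral_rpow (Or.inl (by linarith)), Real.zero_rpow (by linarith)]
    · congr 1
      rw [show -s + 1 = 1 - s by ring, sub_zero]
    · filter_upwards [ae_restrict_mem measurableSet_Ioc] with y hy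
      exact Real.rpow_nonneg hy.1.le _
  rw [mul_div_assoc, ENNReal.ofReal_mul (mul_nonneg n.cast_nonneg ballVolume_pos.le), ← hk,
    ← lintegral_indicator hm, ← lintegral_indicator measurableSet_Ioc]
  have := lintegral_norm_comp hn (f := (Iic a).indicator
    fun y => ENNReal.ofReal (1 / y ^ ((n : ℝ) + s)) * ENNReal.ofReal y)
    (Measurable.indicator (by fun_prop) measurableSet_Iic)
  refine Eq.trans ?_ (this.trans ?_)
  · rfl
  · rw [← lintegral_indicator measurableSet_Ioi]
    congr 2
    ext y
    by_cases hy0 : 0 < y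
    · by_cases hy : y ≤ a
      · simp only [indicator, mem_Ioi, mem_Ioc, mem_Iic, hy, hy0, if_true, and_self]
        rw [← mul_assoc, ← ENNReal.ofReal_mul (by positivity), pow_pred_mul_rpow_neg hn s hy0,
          ← ENNReal.ofReal_mul (by positivity)]
        congr 1
        nth_rewrite 2 [← Real.rpow_one y]
        rw [← Real.rpow_add hy0]
        congr 1
        ring
      · simp [indicator, hy]
    · simp [indicator, hy0]

theorem lintegral_perimeterKernel_annulus (hn : 2 ≤ n) {s a : ℝ} (hs : 0 < s) (ha : 0 < a) :
    ENNReal.ofReal (n * ballVolume n * a ^ (-s) * (1 - 2 ^ (-s)) / s) ≤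
      ∫⁻ h in {h : EuclideanSpace ℝ (Fin n) | a < ‖h‖ ∧ ‖h‖ ≤ 2 * a}, perimeterKernel n s h := by
  have h1 := lintegral_perimeterKernel_exterior hn hs ha
  have h2 := lintegral_perimeterKernel_exterior hn hs (show 0 < 2 * a by positivity)
  have hsub : {h : EuclideanSpace ℝ (Fin n) | a < ‖h‖} ⊆
      {h | a < ‖h‖ ∧ ‖h‖ ≤ 2 * a} ∪ {h | 2 * a < ‖h‖} := by
    intro h hh
    rcases le_or_gt ‖h‖ (2 * a) with h' | h'
    exacts [Or.inl ⟨hh, h'⟩, Or.inr h']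
  have h3 := (lintegral_mono_set hsub).trans
    (lintegral_union_le (perimeterKernel n s) _ _ (μ := volume))
  rw [h1, h2] at h3
  have hw := ballVolume_pos (n := n)
  have : ENNReal.ofReal (n * ballVolume n * a ^ (-s) / s) =
      ENNReal.ofReal (n * ballVolume n * a ^ (-s) * (1 - 2 ^ (-s)) / s) +
      ENNReal.ofReal (n * ballVolume n * (2 * a) ^ (-s) / s) := by
    rw [← ENNReal.ofReal_add]
    · congr 1
      rw [Real.mul_rpow (by norm_num) ha.le]
      ring
    · have : (2 : ℝ) ^ (-s) ≤ 1 := Real.rpow_le_one_of_one_le_of_nonpos (by norm_num) (by linarith)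
      have : 0 ≤ 1 - (2 : ℝ) ^ (-s) := by linarith
      positivity
    · positivity
  rw [this] at h3
  exact (ENNReal.add_le_add_iff_right ENNReal.ofReal_ne_top).1 h3

/-! ### The `s`-perimeter as an integral over translations -/

theorem measurableSet_mem_and_sub_mem {A B : Set (EuclideanSpace ℝ (Fin n))}
    (hA : MeasurableSet A) (hB : MeasurableSet B) :
    MeasurableSet {p : EuclideanSpace ℝ (Fin n) × EuclideanSpace ℝ (Fin n) |
      p.2 ∈ A ∧ p.2 - p.1 ∈ B} :=
  (measurable_snd hA).inter ((measurable_snd.sub measurable_fst) hB)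

theorem measurable_translateDiff {F : Set (EuclideanSpace ℝ (Fin n))} (hF : MeasurableSet F) :
    Measurable (translateDiff F) :=
  measurable_measure_prodMk_left (measurableSet_mem_and_sub_mem hF hF.compl)

theorem sPerimeter_eq_lintegral_translateDiff (s : ℝ) {F : Set (EuclideanSpace ℝ (Fin n))}
    (hF : MeasurableSet F) :
    sPerimeter s F = ∫⁻ h, perimeterKernel n s h * translateDiff F h := by
  have h1 : ∀ x, ∫⁻ y in Fᶜ, ENNReal.ofReal (1 / ‖x - y‖ ^ ((n : ℝ) + s)) =
      ∫⁻ h, perimeterKernel n s h * (Fᶜ).indicator 1 (x - h) := by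
    intro x
    rw [← lintegral_indicator hF.compl, ← lintegral_sub_left_eq_self _ x]
    refine lintegral_congr fun h => ?_
    by_cases hx : x - h ∈ F <;> simp [indicator, hx, perimeterKernel]
  have h2 : ∀ h, perimeterKernel n s h * translateDiff F h =
      ∫⁻ x in F, perimeterKernel n s h * (Fᶜ).indicator 1 (x - h) := by
    intro h
    have hm : MeasurableSet {x | x - h ∉ F} := (measurable_id.sub_const h) hF.compl
    have hmeas : Measurable fun x => (Fᶜ).indicator (1 : EuclideanSpace ℝ (Fin n) → ENNReal) (x - h) :=
      (measurable_one.indicator hF.compl).comp (measurable_id.sub_const h)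
    rw [lintegral_const_mul _ hmeas]
    congr 1
    have : (fun x => (Fᶜ).indicator (1 : EuclideanSpace ℝ (Fin n) → ENNReal) (x - h)) = {x | x - h ∉ F}.indicator 1 := rfl
    rw [this, lintegral_indicator_one hm, Measure.restrict_apply hm, inter_comm, translateDiff]
  unfold sPerimeter
  simp_rw [h1, h2]
  rw [lintegral_lintegral_swap]
  refine Measurable.aemeasurable ?_
  exact ((measurable_perimeterKernel s).comp measurable_snd).mul
    ((measurable_one.indicator hF.compl).comp (measurable_fst.sub measurable_snd))

/-- A point that leaves `F` under the shift by `2h` leaves it in the first or in the second shift by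
`h`. -/
theorem translateDiff_two_smul_le (F : Set (EuclideanSpace ℝ (Fin n)))
    (h : EuclideanSpace ℝ (Fin n)) : translateDiff F ((2 : ℝ) • h) ≤ 2 * translateDiff F h := by
  have hsub : F ∩ {x | x - (2 : ℝ) • h ∉ F} ⊆
      (F ∩ {x | x - h ∉ F}) ∪ (fun x => x - h) ⁻¹' (F ∩ {x | x - h ∉ F}) := by
    rintro x ⟨hx, hx'⟩
    by_cases hh : x - h ∈ F
    · refine Or.inr ⟨hh, ?_⟩
      simpa [two_smul, sub_sub] using hx'
    · exact Or.inl ⟨hx, hh⟩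
  calc translateDiff F ((2 : ℝ) • h) ≤ _ := measure_mono hsub
    _ ≤ _ := measure_union_le _ _
    _ = 2 * translateDiff F h := by
      rw [(measurePreserving_sub_right volume h).measure_preimage_emb
        (measurableEmbedding_subRight h), two_mul]
      rfl

theorem lintegral_comp_two_smul {f : EuclideanSpace ℝ (Fin n) → ENNReal} (hf : Measurable f) :
    ∫⁻ x, f x = 2 ^ n * ∫⁻ x, f ((2 : ℝ) • x) := by
  have h := lintegral_map (μ := volume) hf (measurable_const_smul (2 : ℝ))
  rw [Measure.map_addHaar_smul _ two_ne_zero, lintegral_smul_measure,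
    finrank_euclideanSpace_fin] at h
  rw [← h, smul_eq_mul, ← mul_assoc, abs_of_pos (by positivity), ENNReal.ofReal_inv_of_pos (by positivity),
    ENNReal.ofReal_pow (by norm_num), ENNReal.ofReal_ofNat, ENNReal.mul_inv_cancel (by simp) (by simp),
    one_mul]

theorem perimeterKernel_two_smul (s : ℝ) (h : EuclideanSpace ℝ (Fin n)) :
    2 ^ n * perimeterKernel n s ((2 : ℝ) • h) =
      ENNReal.ofReal (2 ^ (-s)) * perimeterKernel n s h := by
  unfold perimeterKernel
  rw [← ENNReal.ofReal_mul (by positivity), show (2 : ENNReal) ^ n = ENNReal.ofReal (2 ^ n) by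
    rw [ENNReal.ofReal_pow (by norm_num), ENNReal.ofReal_ofNat], ← ENNReal.ofReal_mul (by positivity)]
  congr 1
  rw [norm_smul, Real.norm_ofNat, Real.mul_rpow (by norm_num) (norm_nonneg _), Real.rpow_neg
    (by norm_num), Real.rpow_add (by norm_num), Real.rpow_natCast]
  have : (0 : ℝ) < 2 ^ s := by positivity
  simp only [one_div, mul_inv]
  rw [← mul_assoc, ← mul_assoc, mul_inv_cancel₀ (by positivity), one_mul]

/-- Substituting `h ↦ 2h` costs `2^(-s)` from kernel and Jacobian, and subadditivity of
`translateDiff` costs `2`. The factor `2^(1-s)` tends to `1` as `s → 1`; this is the source of the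
blow-up `1/(1-s)` in the isoperimetric inequality. -/
theorem lintegral_ball_two_mul_le {s ρ : ℝ} {F : Set (EuclideanSpace ℝ (Fin n))}
    (hF : MeasurableSet F) :
    ∫⁻ h in {h | ‖h‖ ≤ 2 * ρ}, perimeterKernel n s h * translateDiff F h ≤
      ENNReal.ofReal (2 ^ (1 - s)) *
        ∫⁻ h in {h | ‖h‖ ≤ ρ}, perimeterKernel n s h * translateDiff F h := by
  have hm : ∀ a : ℝ, MeasurableSet {h : EuclideanSpace ℝ (Fin n) | ‖h‖ ≤ a} := fun a =>
    measurableSet_le measurable_norm measurable_const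
  have hf : Measurable fun h => perimeterKernel n s h * translateDiff F h :=
    (measurable_perimeterKernel s).mul (measurable_translateDiff hF)
  have hf2 : Measurable fun x => {h | ‖h‖ ≤ 2 * ρ}.indicator
      (fun h => perimeterKernel n s h * translateDiff F h) ((2 : ℝ) • x) :=
    (hf.indicator (hm _)).comp (measurable_const_smul _)
  rw [← lintegral_indicator (hm _), ← lintegral_indicator (hm _),
    lintegral_comp_two_smul (hf.indicator (hm _)), ← lintegral_const_mul _ (hf.indicator (hm _)),
    ← lintegral_const_mul _ hf2]
  refine lintegral_mono fun h => ?_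
  by_cases hh : ‖h‖ ≤ ρ
  · have hh' : ‖(2 : ℝ) • h‖ ≤ 2 * ρ := by rw [norm_smul, Real.norm_ofNat]; linarith
    simp only [indicator, mem_ofPred_eq, hh, hh', if_true]
    rw [← mul_assoc, perimeterKernel_two_smul]
    calc _ ≤ ENNReal.ofReal (2 ^ (-s)) * perimeterKernel n s h * (2 * translateDiff F h) := by
          gcongr
          exact translateDiff_two_smul_le F h
      _ = ENNReal.ofReal (2 ^ (-s)) * ENNReal.ofReal 2 * (perimeterKernel n s h * translateDiff F h) := by
          rw [ENNReal.ofReal_ofNat]; ring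
      _ = _ := by
          rw [← ENNReal.ofReal_mul (by positivity)]
          congr 2
          rw [sub_eq_add_neg, Real.rpow_add (by norm_num), Real.rpow_one, mul_comm]
  · have hh' : ¬ ‖(2 : ℝ) • h‖ ≤ 2 * ρ := by rw [norm_smul, Real.norm_ofNat]; linarith
    simp [indicator, hh, hh']

theorem lintegral_volume_inter_sub_mem {A B : Set (EuclideanSpace ℝ (Fin n))}
    (hA : MeasurableSet A) (hB : MeasurableSet B) :
    ∫⁻ h, volume {x | x ∈ A ∧ x - h ∈ B} = volume B * volume A := by
  have hm := measurableSet_mem_and_sub_mem hA hB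
  have h1 := Measure.prod_apply hm (μ := volume) (ν := volume)
  have h2 := Measure.prod_apply_symm hm (μ := volume) (ν := volume)
  refine (h1.symm.trans h2).trans ?_
  have h3 : ∀ y, volume ((fun x => (x, y)) ⁻¹' {p : EuclideanSpace ℝ (Fin n) ×
      EuclideanSpace ℝ (Fin n) | p.2 ∈ A ∧ p.2 - p.1 ∈ B}) =
      A.indicator (fun _ => volume B) y := by
    intro y
    by_cases hy : y ∈ A
    · simp only [hy, indicator_of_mem, preimage_ofPred_eq, true_and]
      exact (Measure.measurePreserving_sub_left volume y).measure_preimage hB.nullMeasurableSet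
    · simp [hy]
  simp_rw [h3]
  rw [lintegral_indicator hA, setLIntegral_const]

/-! ### The fractional isoperimetric inequality -/

/-- Since `|F \ (F+h)| = |F| - |F ∩ (F+h)|` and the overlaps integrate to `|F|²`, long shifts see
almost all of `F`; the error term bounds the kernel by its value at radius `ρ`. -/
theorem volume_mul_lintegral_perimeterKernel_le {s ρ : ℝ} (hs : 0 < s) (hρ : 0 < ρ)
    {F S : Set (EuclideanSpace ℝ (Fin n))} (hF : MeasurableSet F) (hS : MeasurableSet S)
    (hSρ : ∀ h ∈ S, ρ < ‖h‖) :
    volume F * ∫⁻ h in S, perimeterKernel n s h ≤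
      (∫⁻ h in S, perimeterKernel n s h * translateDiff F h) +
        ENNReal.ofReal (ρ ^ (-((n : ℝ) + s))) * volume F * volume F := by
  have hmi := measurableSet_mem_and_sub_mem hF hF
  have hI := lintegral_volume_inter_sub_mem hF hF
  have hsplit : ∀ h, volume F = translateDiff F h + volume {x | x ∈ F ∧ x - h ∈ F} := by
    intro h
    have hm : MeasurableSet {x | x - h ∈ F} := (measurable_id.sub_const h) hF
    rw [add_comm, ← measure_inter_add_sdiff F hm]
    rfl
  calc volume F * ∫⁻ h in S, perimeterKernel n s h
      = ∫⁻ h in S, (perimeterKernel n s h * translateDiff F h +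
          perimeterKernel n s h * volume {x | x ∈ F ∧ x - h ∈ F}) := by
        rw [← lintegral_const_mul _ (measurable_perimeterKernel s)]
        refine lintegral_congr fun h => ?_
        rw [← mul_add, ← hsplit, mul_comm]
    _ = (∫⁻ h in S, perimeterKernel n s h * translateDiff F h) +
          ∫⁻ h in S, perimeterKernel n s h * volume {x | x ∈ F ∧ x - h ∈ F} :=
        lintegral_add_left ((measurable_perimeterKernel s).mul (measurable_translateDiff hF)) _
    _ ≤ (∫⁻ h in S, perimeterKernel n s h * translateDiff F h) +
          ∫⁻ h in S, ENNReal.ofReal (ρ ^ (-((n : ℝ) + s))) * volume {x | x ∈ F ∧ x - h ∈ F} := by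
        refine add_le_add le_rfl ?_
        refine setLIntegral_mono' hS fun h hh => ?_
        gcongr
        refine ENNReal.ofReal_le_ofReal ?_
        rw [Real.rpow_neg hρ.le, ← one_div]
        have := hSρ h hh
        gcongr
    _ ≤ _ := by
        refine add_le_add le_rfl ?_
        have hmeas : Measurable fun h => volume {x | x ∈ F ∧ x - h ∈ F} :=
          measurable_measure_prodMk_left hmi
        rw [lintegral_const_mul _ hmeas, mul_assoc, ← hI]
        gcongr
        exact Measure.restrict_le_self

theorem one_sub_two_rpow_le {t : ℝ} (ht : 0 ≤ t) : 1 - (2 : ℝ) ^ (-t) ≤ 0.7 * t := by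
  have h1 := Real.add_one_le_exp (Real.log 2 * -t)
  rw [← Real.rpow_def_of_pos (by norm_num)] at h1
  nlinarith [Real.log_two_lt_d9]

theorem half_le_one_sub_two_rpow_div {s : ℝ} (hs : 0 < s) (hs1 : s < 1) :
    1 / 2 ≤ (1 - (2 : ℝ) ^ (-s)) / s := by
  have h1 := rpow_one_add_le_one_add_mul_self (s := -1 / 2) (by norm_num) hs.le hs1.le
  rw [show (1 : ℝ) + -1 / 2 = 2⁻¹ by norm_num, Real.inv_rpow (by norm_num),
    ← Real.rpow_neg (by norm_num)] at h1
  rw [le_div_iff₀ hs]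
  linarith

theorem eight_le_mul_two_pow (hn : 2 ≤ n) : (8 : ℝ) ≤ n * 2 ^ n := by
  have h1 : (2 : ℝ) ≤ n := by exact_mod_cast hn
  have h2 : (2 : ℝ) ^ 2 ≤ 2 ^ n := pow_le_pow_right₀ (by norm_num) hn
  nlinarith

/-- A fractional isoperimetric inequality with an explicit, non-optimal constant. -/
theorem le_sPerimeter_of_volume_eq (hn : 2 ≤ n) {s R : ℝ} (hs : 0 < s) (hs1 : s < 1) (hR : 0 < R)
    {F : Set (EuclideanSpace ℝ (Fin n))} (hF : MeasurableSet F)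
    (hv : volume F = ENNReal.ofReal (ballVolume n * R ^ n)) :
    ENNReal.ofReal (5 / 16 * (n * ballVolume n * (2 * R) ^ (-s) / (s * (1 - s))) *
      (ballVolume n * R ^ n)) ≤ sPerimeter s F := by
  rcases eq_or_ne (sPerimeter s F) ⊤ with hP | hP
  · simp [hP]
  have hw := ballVolume_pos (n := n)
  set w := ballVolume n
  -- Doubling the radius makes the overlap error `T/(n 2^n)`, at most `T/8`.
  set ρ := 2 * R
  have hρ : 0 < ρ := by positivity
  set v := w * R ^ n
  have hv0 : 0 < v := by positivity
  rw [sPerimeter_eq_lintegral_translateDiff s hF] at hP ⊢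
  have hms : ∀ a : ℝ, MeasurableSet {h : EuclideanSpace ℝ (Fin n) | a < ‖h‖} := fun a =>
    measurableSet_lt measurable_const measurable_norm
  have hmi : ∀ a : ℝ, MeasurableSet {h : EuclideanSpace ℝ (Fin n) | ‖h‖ ≤ a} := fun a =>
    measurableSet_le measurable_norm measurable_const
  have hma : MeasurableSet {h : EuclideanSpace ℝ (Fin n) | ρ < ‖h‖ ∧ ‖h‖ ≤ 2 * ρ} :=
    (hms _).inter (hmi _)
  have hfin : ∀ S, ∫⁻ h in S, perimeterKernel n s h * translateDiff F h ≠ ⊤ := fun S =>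
    ne_top_of_le_ne_top hP (setLIntegral_le_lintegral _ _)
  have hle : ∀ S, (∫⁻ h in S, perimeterKernel n s h * translateDiff F h).toReal ≤
      (∫⁻ h, perimeterKernel n s h * translateDiff F h).toReal := fun S =>
    ENNReal.toReal_mono hP (setLIntegral_le_lintegral _ _)
  have h8 := eight_le_mul_two_pow hn
  have hn0 : (0 : ℝ) < n := by positivity
  set T := v * (n * w * ρ ^ (-s))
  have hT : 0 < T := by positivity
  have herr : ρ ^ (-((n : ℝ) + s)) * v * v ≤ T / 8 := by
    have : ρ ^ (-((n : ℝ) + s)) * v * v = T / (n * 2 ^ n) := by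
      rw [neg_add, Real.rpow_add hρ, Real.rpow_neg hρ.le n, Real.rpow_natCast, mul_pow]
      simp only [T, v]
      field_simp
    rw [this]
    gcongr
  -- transfer of the lower bound on `S` to real numbers
  have hlow : ∀ (S : Set (EuclideanSpace ℝ (Fin n))) (c : ℝ), MeasurableSet S →
      (∀ h ∈ S, ρ < ‖h‖) → ENNReal.ofReal c ≤ ∫⁻ h in S, perimeterKernel n s h →
      v * c ≤ (∫⁻ h in S, perimeterKernel n s h * translateDiff F h).toReal + T / 8 := by
    intro S c hS hSρ hc
    have h1 := volume_mul_lintegral_perimeterKernel_le hs hρ hF hS hSρ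
    have h2 := (mul_le_mul_right hc (volume F)).trans h1
    rw [hv, ← ENNReal.ofReal_mul hv0.le, ← ENNReal.ofReal_mul (by positivity),
      ← ENNReal.ofReal_mul (by positivity), ← ENNReal.ofReal_toReal (hfin S),
      ← ENNReal.ofReal_add (by positivity) (by positivity),
      ENNReal.ofReal_le_ofReal_iff (by positivity)] at h2
    linarith
  have hext := hlow _ _ (hms ρ) (fun h hh => hh) (lintegral_perimeterKernel_exterior hn hs hρ).ge
  have hann := hlow _ _ hma (fun h hh => hh.1) (lintegral_perimeterKernel_annulus hn hs hρ)
  have hscale := lintegral_ball_two_mul_le (s := s) (ρ := ρ) hF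
  have hsplit : (∫⁻ h in {h | ρ < ‖h‖ ∧ ‖h‖ ≤ 2 * ρ}, perimeterKernel n s h * translateDiff F h) +
      ∫⁻ h in {h | ‖h‖ ≤ ρ}, perimeterKernel n s h * translateDiff F h ≤
      ∫⁻ h in {h | ‖h‖ ≤ 2 * ρ}, perimeterKernel n s h * translateDiff F h := by
    rw [← lintegral_union (hmi ρ)]
    · refine lintegral_mono_set ?_
      rintro h (hh | hh)
      · exact hh.2
      · have : ‖h‖ ≤ ρ := hh
        show ‖h‖ ≤ 2 * ρ
        linarith
    · rw [Set.disjoint_left]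
      intro h hh hh'
      exact absurd hh.1 (not_lt.2 hh')
  have hscale' := ENNReal.toReal_mono (ENNReal.mul_ne_top ENNReal.ofReal_ne_top (hfin _)) hscale
  have hsplit' := ENNReal.toReal_mono (hfin _) hsplit
  rw [ENNReal.toReal_mul, ENNReal.toReal_ofReal (by positivity)] at hscale'
  rw [ENNReal.toReal_add (hfin _) (hfin _)] at hsplit'
  have hL := hle {h | ‖h‖ ≤ 2 * ρ}
  have hE := hle {h | ρ < ‖h‖}
  refine ENNReal.ofReal_le_of_le_toReal ?_
  set P := (∫⁻ h, perimeterKernel n s h * translateDiff F h).toReal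
  set A := (∫⁻ h in {h | ρ < ‖h‖ ∧ ‖h‖ ≤ 2 * ρ}, perimeterKernel n s h * translateDiff F h).toReal
  set I := (∫⁻ h in {h | ‖h‖ ≤ ρ}, perimeterKernel n s h * translateDiff F h).toReal
  set L := (∫⁻ h in {h | ‖h‖ ≤ 2 * ρ}, perimeterKernel n s h * translateDiff F h).toReal
  have hA : 3 / 8 * T ≤ A := by
    have h1 := half_le_one_sub_two_rpow_div hs hs1
    have h2 : v * (n * w * ρ ^ (-s) * (1 - 2 ^ (-s)) / s) = T * ((1 - 2 ^ (-s)) / s) := by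
      simp only [T]; ring
    rw [h2] at hann
    nlinarith
  have hI : 2 ^ (-(1 - s)) * L ≤ I := by
    rw [Real.rpow_neg (by norm_num), inv_mul_le_iff₀ (by positivity)]
    exact hscale'
  have hL0 : 0 ≤ L := ENNReal.toReal_nonneg
  -- Useful for `s` near `1`: `A + I ≤ L` and `I ≥ 2^(-(1-s)) L` force `A ≤ (1 - 2^(-(1-s))) L`, and
  -- `0.7` exceeds `log 2`.
  have hP1 : 3 / 8 * T ≤ 0.7 * (1 - s) * P := by
    have h1 := one_sub_two_rpow_le (sub_pos.2 hs1).le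
    have h2 : 3 / 8 * T ≤ (1 - 2 ^ (-(1 - s))) * L := by linarith
    calc _ ≤ _ := h2
      _ ≤ 0.7 * (1 - s) * L := by gcongr
      _ ≤ _ := by
        have := sub_pos.2 hs1
        gcongr
  -- Useful for `s` near `0`: the exterior region alone contributes `T/s - T/8`.
  have hP2 : 7 / 8 * T ≤ s * P := by
    have h2 : v * (n * w * ρ ^ (-s) / s) = T / s := by
      simp only [T]; ring
    rw [h2, div_le_iff₀ hs] at hext
    nlinarith
  have h1s := sub_pos.2 hs1
  have : 5 / 16 * (n * w * ρ ^ (-s) / (s * (1 - s))) * v = 5 / 16 * T / (s * (1 - s)) := by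
    simp only [T]; ring
  rw [this, div_le_iff₀ (by positivity)]
  -- Weighting the two bounds by `s` and `1 - s` gives `T ≤ (28/15 + 8/7) s (1-s) P`, and the
  -- bracket is below `16/5`.
  have h3 : s * (3 / 8 * T) ≤ s * (0.7 * (1 - s) * P) := by gcongr
  have h4 : (1 - s) * (7 / 8 * T) ≤ (1 - s) * (s * P) := by gcongr
  nlinarith

/-! ### Upper bound for the `s`-perimeter of a ball -/

theorem ball_half_smul_subset {E : Type*} [NormedAddCommGroup E] [NormedSpace ℝ E] (h : E) (r : ℝ) :
    Metric.ball ((2⁻¹ : ℝ) • h) (r - ‖h‖ / 2) ⊆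
      Metric.ball 0 r ∩ {x | x - h ∈ Metric.ball 0 r} := by
  have hnorm : ‖(2⁻¹ : ℝ) • h‖ = ‖h‖ / 2 := by
    rw [norm_smul, norm_inv, Real.norm_ofNat, inv_mul_eq_div]
  have hhalf : h = (2⁻¹ : ℝ) • h + (2⁻¹ : ℝ) • h := by
    rw [← add_smul, show (2⁻¹ + 2⁻¹ : ℝ) = 1 by norm_num, one_smul]
  intro x hx
  rw [mem_ball_iff_norm] at hx
  refine ⟨mem_ball_zero_iff.2 ?_, mem_ball_zero_iff.2 ?_⟩
  · have := norm_add_le (x - (2⁻¹ : ℝ) • h) ((2⁻¹ : ℝ) • h)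
    rw [sub_add_cancel] at this
    linarith
  · have := norm_sub_le (x - (2⁻¹ : ℝ) • h) ((2⁻¹ : ℝ) • h)
    rw [sub_sub, ← hhalf] at this
    linarith

/-- The overlap of the two balls contains a ball of radius `r - ‖h‖/2` about `h/2`, and Bernoulli's
inequality linearises its volume. For `‖h‖ ≥ 2r` the trivial bound suffices. -/
theorem translateDiff_ball_le (hn : 2 ≤ n) {r : ℝ} (hr : 0 < r) (h : EuclideanSpace ℝ (Fin n)) :
    translateDiff (Metric.ball 0 r) h ≤
      ENNReal.ofReal (ballVolume n * r ^ n * (n / (2 * r))) * ENNReal.ofReal ‖h‖ := by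
  have hw := ballVolume_pos (n := n)
  rw [← ENNReal.ofReal_mul (by positivity)]
  rcases le_or_gt (2 * r) ‖h‖ with hh | hh
  · refine (measure_mono inter_subset_left).trans ?_
    rw [volume_ball_eq hn _ hr.le]
    refine ENNReal.ofReal_le_ofReal ?_
    have h1 : (2 : ℝ) ≤ n := by exact_mod_cast hn
    have : 1 ≤ n / (2 * r) * ‖h‖ := by
      rw [div_mul_eq_mul_div, le_div_iff₀ (by positivity)]
      nlinarith
    nlinarith [show 0 < ballVolume n * r ^ n by positivity]
  · have hr' : 0 ≤ r - ‖h‖ / 2 := by linarith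
    have hsub := ball_half_smul_subset h r
    have hm : MeasurableSet {x | x - h ∈ Metric.ball (0 : EuclideanSpace ℝ (Fin n)) r} :=
      (measurable_id.sub_const h) measurableSet_ball
    have h1 := measure_inter_add_sdiff (μ := volume)
      (Metric.ball (0 : EuclideanSpace ℝ (Fin n)) r) hm
    have h2 : ENNReal.ofReal (ballVolume n * (r - ‖h‖ / 2) ^ n) +
        translateDiff (Metric.ball 0 r) h ≤ ENNReal.ofReal (ballVolume n * r ^ n) := by
      rw [← volume_ball_eq hn ((2⁻¹ : ℝ) • h) hr', ← volume_ball_eq hn 0 hr.le, ← h1]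
      exact add_le_add (measure_mono hsub) le_rfl
    have h3 : ENNReal.ofReal (ballVolume n * r ^ n) ≤
        ENNReal.ofReal (ballVolume n * (r - ‖h‖ / 2) ^ n) +
        ENNReal.ofReal (ballVolume n * r ^ n * (n / (2 * r)) * ‖h‖) := by
      rw [← ENNReal.ofReal_add (by positivity) (by positivity)]
      refine ENNReal.ofReal_le_ofReal ?_
      have hb := one_add_mul_le_pow (a := -(‖h‖ / (2 * r))) (by
        have : ‖h‖ / (2 * r) ≤ 1 := by rw [div_le_one (by positivity)]; exact hh.le
        linarith) n
      have h4 : (r - ‖h‖ / 2) ^ n = r ^ n * (1 + -(‖h‖ / (2 * r))) ^ n := by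
        rw [← mul_pow]
        congr 1
        field_simp
        ring
      rw [h4]
      have h5 : ballVolume n * r ^ n * (1 + n * -(‖h‖ / (2 * r))) ≤
        ballVolume n * r ^ n * (1 + -(‖h‖ / (2 * r))) ^ n := by gcongr
      have h6 : ballVolume n * r ^ n * (1 + n * -(‖h‖ / (2 * r))) = ballVolume n * r ^ n -
        ballVolume n * r ^ n * (n / (2 * r)) * ‖h‖ := by ring
      nlinarith
    exact (ENNReal.add_le_add_iff_left ENNReal.ofReal_ne_top).1 (h2.trans h3)

theorem lintegral_translateDiff_ball_le (hn : 2 ≤ n) {s r : ℝ} (hs : 0 < s) (hs1 : s < 1)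
    (hr : 0 < r) :
    ∫⁻ h, perimeterKernel n s h * translateDiff (Metric.ball 0 r) h ≤
      ENNReal.ofReal (n * ballVolume n ^ 2 * r ^ n * (2 * r / n) ^ (-s) / (s * (1 - s))) := by
  have hw := ballVolume_pos (n := n)
  have hn0 : (0 : ℝ) < n := by positivity
  -- The radius at which the linear bound and the trivial bound `|B_r|` for `translateDiff`
  -- coincide.
  set a := 2 * r / n
  have ha : 0 < a := by positivity
  have h1s := sub_pos.2 hs1
  have hmi : MeasurableSet {h : EuclideanSpace ℝ (Fin n) | ‖h‖ ≤ a} :=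
    measurableSet_le measurable_norm measurable_const
  rw [← lintegral_add_compl _ hmi]
  have hcompl : {h : EuclideanSpace ℝ (Fin n) | ‖h‖ ≤ a}ᶜ = {h | a < ‖h‖} := by
    ext h; simp
  rw [hcompl]
  have h1 : ∫⁻ h in {h | ‖h‖ ≤ a}, perimeterKernel n s h * translateDiff (Metric.ball 0 r) h ≤
      ENNReal.ofReal (n * ballVolume n ^ 2 * r ^ n * a ^ (-s) / (1 - s)) := by
    calc _ ≤ ∫⁻ h in {h | ‖h‖ ≤ a}, ENNReal.ofReal (ballVolume n * r ^ n * (n / (2 * r))) *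
            (perimeterKernel n s h * ENNReal.ofReal ‖h‖) := by
          refine lintegral_mono fun h => ?_
          rw [mul_left_comm]
          exact mul_le_mul_right (translateDiff_ball_le hn hr h) _
      _ = _ := by
          rw [lintegral_const_mul _ (by fun_prop),
            lintegral_perimeterKernel_mul_norm_interior hn hs1 ha,
            ← ENNReal.ofReal_mul (by positivity)]
          congr 1
          rw [sub_eq_add_neg 1 s, Real.rpow_add ha, Real.rpow_one]
          simp only [a]
          field_simp
  have h2 : ∫⁻ h in {h | a < ‖h‖}, perimeterKernel n s h * translateDiff (Metric.ball 0 r) h ≤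
      ENNReal.ofReal (n * ballVolume n ^ 2 * r ^ n * a ^ (-s) / s) := by
    calc _ ≤ ∫⁻ h in {h | a < ‖h‖}, perimeterKernel n s h *
            ENNReal.ofReal (ballVolume n * r ^ n) := by
          refine lintegral_mono fun h => ?_
          refine mul_le_mul_right ((measure_mono inter_subset_left).trans ?_) _
          rw [volume_ball_eq hn _ hr.le]
      _ = _ := by
          rw [lintegral_mul_const _ (by fun_prop), lintegral_perimeterKernel_exterior hn hs ha,
            ← ENNReal.ofReal_mul (by positivity)]
          congr 1
          ring
  refine (add_le_add h1 h2).trans ?_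
  rw [← ENNReal.ofReal_add (by positivity) (by positivity)]
  refine ENNReal.ofReal_le_ofReal (le_of_eq ?_)
  field_simp
  ring

/-! ### A lower bound for Besicovitch's constant -/

/-- The closed unit balls centred at `±e_i` all contain `0`, so no two lie in one disjoint
subfamily; none contains another's centre, so all must be selected. -/
theorem two_mul_le_of_isBesicovitchConst {N : ℕ} (hN : IsBesicovitchConst n N) : 2 * n ≤ N := by
  let c : Fin n × Bool → EuclideanSpace ℝ (Fin n) := fun p =>
    EuclideanSpace.single p.1 (if p.2 then (1 : ℝ) else -1)
  have hc1 : ∀ p, ‖c p‖ = 1 := by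
    rintro ⟨i, b⟩
    cases b <;> simp [c]
  have hdist : ∀ p q, dist (c p) (c q) ≤ 1 → p = q := by
    rintro ⟨i, b⟩ ⟨j, b'⟩ h
    by_contra hne
    by_cases hij : i = j
    · subst hij
      have hbb : b ≠ b' := fun hb => hne (by rw [hb])
      simp only [c, PiLp.dist_single_same] at h
      cases b <;> cases b' <;> first | exact hbb rfl | norm_num [Real.dist_eq] at h
    · have h0 : ‖c (i, b) - c (j, b')‖ ^ 2 = 2 := by
        have hin : inner ℝ (c (i, b)) (c (j, b')) = 0 := by
          simp [c, EuclideanSpace.inner_single_left, hij]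
        rw [norm_sub_sq_real, hin, hc1, hc1]
        norm_num
      rw [dist_eq_norm] at h
      nlinarith [norm_nonneg (c (i, b) - c (j, b'))]
  obtain ⟨G, hG, hcov⟩ := hN (range fun p => (c p, (1 : ℝ))) (by rintro _ ⟨p, rfl⟩; exact one_pos)
    ⟨1, by rintro _ ⟨_, ⟨p, rfl⟩, rfl⟩; exact le_rfl⟩
  have hex : ∀ p, ∃ i, (c p, (1 : ℝ)) ∈ G i := by
    intro p
    have := hcov ⟨_, ⟨p, rfl⟩, rfl⟩
    simp only [mem_iUnion] at this
    obtain ⟨i, q, hq, hpq⟩ := this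
    obtain ⟨p', rfl⟩ := (hG i).1 hq
    rw [hdist p p' hpq]
    exact ⟨i, hq⟩
  choose f hf using hex
  have hinj : Function.Injective f := by
    intro p q hpq
    by_contra hne
    have hne' : (c p, (1 : ℝ)) ≠ (c q, 1) := by
      intro h
      have h1 : c p = c q := congrArg Prod.fst h
      exact hne (hdist p q (by rw [h1, dist_self]; exact zero_le_one))
    have h1 := (hG (f p)).2.2 (hf p) (hpq ▸ hf q) hne'
    exact Set.disjoint_left.1 h1 (show (0 : EuclideanSpace ℝ (Fin n)) ∈ _ by simp [hc1])
      (by simp [hc1])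
  have := Fintype.card_le_of_injective f hinj
  simp at this
  omega

theorem two_mul_le_besicovitchConst (n : ℕ) : 2 * n ≤ besicovitchConst n :=
  two_mul_le_of_isBesicovitchConst (isBesicovitchConst_besicovitchConst n)

/-! ### The perimeter of the unit ball -/

theorem le_perimeter_unitBall (n : ℕ) :
    ENNReal.ofReal (4 / 5 * (n * ballVolume n)) ≤ perimeter (unitBall n) := by
  let φ : ContDiffBump (0 : EuclideanSpace ℝ (Fin n)) := ⟨1, 5 / 4, by norm_num, by norm_num⟩
  -- The factor `4/5` is the inverse of the outer radius of the bump, which keeps `‖X‖ ≤ 1`; on the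
  -- ball the field is `(4/5) x`.
  let X : EuclideanSpace ℝ (Fin n) → EuclideanSpace ℝ (Fin n) := fun x => (4 / 5 : ℝ) • φ x • x
  have hX : ContDiff ℝ 1 X ∧ HasCompactSupport X ∧ ∀ x, ‖X x‖ ≤ 1 := by
    refine ⟨(φ.contDiff.smul contDiff_id).const_smul _, ?_, fun x => ?_⟩
    · exact (φ.hasCompactSupport.smul_right (f' := fun x => x)).smul_left
        (f := fun _ => (4 / 5 : ℝ))
    · rcases lt_or_ge ‖x‖ (5 / 4) with hx | hx
      · simp only [X, norm_smul, Real.norm_eq_abs, abs_of_nonneg φ.nonneg]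
        have := φ.le_one (x := x)
        have := φ.nonneg (x := x)
        rw [abs_of_pos (by norm_num)]
        nlinarith [norm_nonneg x]
      · have : φ x = 0 := φ.zero_of_le_dist (by rwa [dist_zero_right])
        simp [X, this]
  have hdiv : ∀ x ∈ unitBall n, vdiv X x = 4 / 5 * n := by
    intro x hx
    have hev : X =ᶠ[𝓝 x] fun y => (4 / 5 : ℝ) • y := by
      filter_upwards [Metric.isOpen_ball.mem_nhds hx] with y hy
      have : φ y = 1 := φ.one_of_mem_closedBall (Metric.ball_subset_closedBall hy)
      simp [X, this]
    have hd : fderiv ℝ X x = (4 / 5 : ℝ) • ContinuousLinearMap.id ℝ _ := by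
      rw [hev.fderiv_eq]
      exact ((hasFDerivAt_id x).const_smul (4 / 5 : ℝ)).fderiv
    simp [vdiv, hd, mul_comm]
  have hint : ∫ x in unitBall n, vdiv X x = 4 / 5 * (n * ballVolume n) := by
    rw [setIntegral_congr_fun (s := unitBall n) measurableSet_ball hdiv, setIntegral_const, smul_eq_mul]
    simp only [Measure.real, ballVolume]
    ring
  rw [← hint]
  exact le_iSup₂_of_le X hX le_rfl

/-- After a change of variables only the symmetric difference of the ball and its translate
contributes. -/
theorem abs_setIntegral_unitBall_comp_add_sub_le (hn : 2 ≤ n)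
    {f : EuclideanSpace ℝ (Fin n) → ℝ} (hf : Integrable f) (hf1 : ∀ x, |f x| ≤ 1)
    (v : EuclideanSpace ℝ (Fin n)) :
    |∫ x in unitBall n, (f (x + v) - f x)| ≤ n * ballVolume n * ‖v‖ := by
  have hw := ballVolume_pos (n := n)
  have hmB : MeasurableSet (unitBall n) := measurableSet_ball
  have hmB' : MeasurableSet ((fun x => x - v) ⁻¹' unitBall n) := (measurable_sub_const v) hmB
  have hD : ∀ w, (volume (unitBall n ∩ {x | x - w ∉ unitBall n})).toReal ≤
      ballVolume n * (n / 2) * ‖w‖ := by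
    intro w
    have := translateDiff_ball_le hn one_pos w
    rw [← ENNReal.ofReal_mul (by positivity)] at this
    refine (ENNReal.toReal_mono ENNReal.ofReal_ne_top this).trans (le_of_eq ?_)
    rw [ENNReal.toReal_ofReal (by positivity)]
    simp
  have hbound : ∀ S : Set (EuclideanSpace ℝ (Fin n)), volume S < ⊤ →
      |∫ x in S, f x| ≤ (volume S).toReal := by
    intro S hS
    have := norm_setIntegral_le_of_norm_le_const (μ := volume) (f := f) (C := 1) hS (fun x _ => hf1 x)
    simpa [Measure.real] using this
  have h1 : ∫ x in unitBall n, f (x + v) = ∫ x in (fun x => x - v) ⁻¹' unitBall n, f x := by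
    rw [← integral_indicator hmB, ← integral_indicator hmB',
      ← integral_sub_right_eq_self _ v]
    congr 1
    ext x
    by_cases hx : x - v ∈ unitBall n <;> simp [indicator, hx]
  rw [integral_sub (hf.comp_add_right v).integrableOn hf.integrableOn, h1,
    ← integral_inter_add_sdiff hmB hf.integrableOn,
    ← integral_inter_add_sdiff (s := unitBall n) hmB' hf.integrableOn,
    inter_comm ((fun x => x - v) ⁻¹' unitBall n), add_sub_add_left_eq_sub]
  have hA : volume ((fun x => x - v) ⁻¹' unitBall n \ unitBall n) =
      volume (unitBall n ∩ {x | x - -v ∉ unitBall n}) := by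
    rw [← (measurePreserving_sub_right volume v).measure_preimage_emb
      (measurableEmbedding_subRight v) (unitBall n ∩ {x | x - -v ∉ unitBall n})]
    congr 1
    ext x
    simp
  have hB : unitBall n \ (fun x => x - v) ⁻¹' unitBall n =
      unitBall n ∩ {x | x - v ∉ unitBall n} := rfl
  have hfin : ∀ w, volume (unitBall n ∩ {x | x - w ∉ unitBall n}) < ⊤ := fun w =>
    (measure_mono inter_subset_left).trans_lt measure_ball_lt_top
  have h2 := (hbound _ (hA ▸ hfin (-v))).trans ((congrArg ENNReal.toReal hA).le.trans (hD (-v)))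
  have h3 := (hbound _ (hfin v)).trans (hD v)
  rw [norm_neg] at h2
  rw [hB]
  refine (abs_sub _ _).trans ?_
  linarith

/-- Each partial derivative integrates to a limit of difference quotients, bounded by the
translation estimate. The constant is crude; finiteness matters because `toReal` sends `⊤` to `0`.
-/
theorem perimeter_unitBall_lt_top (hn : 2 ≤ n) : perimeter (unitBall n) < ⊤ := by
  have hw := ballVolume_pos (n := n)
  refine (iSup₂_le fun X hX => ENNReal.ofReal_le_ofReal ?_ :
    perimeter (unitBall n) ≤ ENNReal.ofReal (n * (n * ballVolume n))).trans_lt ENNReal.ofReal_lt_top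
  obtain ⟨hX1, hXc, hXb⟩ := hX
  have hcomp : ∀ i : Fin n, ContDiff ℝ 1 fun x => X x i := fun i => by fun_prop
  have hcs : ∀ i : Fin n, HasCompactSupport fun x => X x i := fun i =>
    hXc.comp_left (g := fun y : EuclideanSpace ℝ (Fin n) => y i) rfl
  have hd : ∀ i x, (fderiv ℝ X x (EuclideanSpace.single i 1)) i =
      fderiv ℝ (fun y => X y i) x (EuclideanSpace.single i 1) := by
    intro i x
    have h1 : HasFDerivAt X (fderiv ℝ X x) x :=
      (hX1.differentiable (by norm_num) x).hasFDerivAt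
    have h2 := ((EuclideanSpace.proj (𝕜 := ℝ) i).hasFDerivAt (x := X x)).comp x h1
    have h3 : fderiv ℝ (fun y => X y i) x = _ := h2.fderiv
    rw [h3]
    rfl
  have hcont : ∀ i : Fin n, Continuous fun x =>
      fderiv ℝ (fun y => X y i) x (EuclideanSpace.single i 1) := fun i =>
    ((hcomp i).continuous_fderiv (by norm_num)).clm_apply continuous_const
  have hint : ∀ i : Fin n, Integrable fun x =>
      fderiv ℝ (fun y => X y i) x (EuclideanSpace.single i 1) := fun i =>
    (hcont i).integrable_of_hasCompactSupport ((hcs i).fderiv_apply ℝ _)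
  simp only [vdiv, hd]
  rw [integral_finsetSum _ fun i _ => (hint i).integrableOn]
  have hmB : MeasurableSet (unitBall n) := measurableSet_ball
  have key : ∀ i : Fin n, ∫ x in unitBall n,
      fderiv ℝ (fun y => X y i) x (EuclideanSpace.single i 1) ≤ n * ballVolume n := by
    intro i
    set f := fun y => X y i
    obtain ⟨C, hC⟩ := (hcomp i).lipschitzWith_of_hasCompactSupport (hcs i) (by norm_num)
    have hf : Integrable f := (hcomp i).continuous.integrable_of_hasCompactSupport (hcs i)
    have hf1 : ∀ x, |f x| ≤ 1 := fun x => by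
      have := (PiLp.norm_apply_le (X x) i).trans (hXb x)
      rwa [Real.norm_eq_abs] at this
    have hg : Integrable ((unitBall n).indicator fun _ => (1 : ℝ)) :=
      (integrable_indicator_iff hmB).2 (integrableOn_const measure_ball_lt_top.ne)
    have hmul : ∀ u : EuclideanSpace ℝ (Fin n) → ℝ,
        ∫ x, u x * (unitBall n).indicator (fun _ => (1 : ℝ)) x = ∫ x in unitBall n, u x := by
      intro u
      rw [← integral_indicator hmB]
      congr 1
      ext x
      by_cases hx : x ∈ unitBall n <;> simp [hx]
    have hlim := hC.integral_inv_smul_sub_mul_tendsto_integral_lineDeriv_mul hg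
      (EuclideanSpace.single i 1)
    rw [hmul fun x => lineDeriv ℝ f x (EuclideanSpace.single i 1)] at hlim
    replace hlim := hlim.congr fun t => hmul fun x =>
      t⁻¹ • (f (x + t • EuclideanSpace.single i 1) - f x)
    have hline : ∀ x, lineDeriv ℝ f x (EuclideanSpace.single i 1) =
        fderiv ℝ f x (EuclideanSpace.single i 1) := fun x =>
      ((hcomp i).differentiable (by norm_num) x).lineDeriv_eq_fderiv
    simp_rw [hline] at hlim
    refine le_of_tendsto hlim ?_
    filter_upwards [self_mem_nhdsWithin] with t ht
    have ht0 : (0 : ℝ) < t := ht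
    simp only [smul_eq_mul]
    rw [integral_const_mul, inv_mul_le_iff₀ ht0]
    refine (le_abs_self _).trans
      ((abs_setIntegral_unitBall_comp_add_sub_le hn hf hf1 _).trans (le_of_eq ?_))
    rw [norm_smul, Real.norm_eq_abs, abs_of_pos ht0]
    simp [mul_comm]
  refine (Finset.sum_le_sum fun i _ => key i).trans ?_
  simp

/-! ### Averaging the `s`-perimeter over translates -/

theorem translateDiff_inter_translate_le (E B : Set (EuclideanSpace ℝ (Fin n)))
    (x h : EuclideanSpace ℝ (Fin n)) :
    translateDiff (E ∩ {y | y - x ∈ B}) h ≤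
      volume {y | y ∈ E ∩ {y | y - h ∉ E} ∧ y - x ∈ B} +
        volume {y | y ∈ E ∧ y - x ∈ B ∩ {z | z - h ∉ B}} := by
  refine (measure_mono fun y hy => ?_).trans (measure_union_le _ _)
  simp only [mem_inter_iff, mem_union, mem_ofPred_eq] at hy ⊢
  rw [sub_right_comm] at hy
  tauto

theorem measurable_volume_mem_inter_and_sub_mem {E B : Set (EuclideanSpace ℝ (Fin n))}
    (hE : MeasurableSet E) (hB : MeasurableSet B) :
    Measurable fun p : EuclideanSpace ℝ (Fin n) × EuclideanSpace ℝ (Fin n) =>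
      volume {y | y ∈ E ∩ {y | y - p.2 ∉ E} ∧ y - p.1 ∈ B} := by
  have hm : MeasurableSet {p : (EuclideanSpace ℝ (Fin n) × EuclideanSpace ℝ (Fin n)) ×
      EuclideanSpace ℝ (Fin n) | p.2 ∈ E ∩ {y | y - p.1.2 ∉ E} ∧ p.2 - p.1.1 ∈ B} :=
    ((measurable_snd hE).inter
      ((measurable_snd.sub (measurable_snd.comp measurable_fst)) hE.compl)).inter
      ((measurable_snd.sub (measurable_fst.comp measurable_fst)) hB)
  exact measurable_measure_prodMk_left hm

theorem measurable_volume_mem_and_sub_mem_inter {E B : Set (EuclideanSpace ℝ (Fin n))}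
    (hE : MeasurableSet E) (hB : MeasurableSet B) :
    Measurable fun p : EuclideanSpace ℝ (Fin n) × EuclideanSpace ℝ (Fin n) =>
      volume {y | y ∈ E ∧ y - p.1 ∈ B ∩ {z | z - p.2 ∉ B}} := by
  have hm : MeasurableSet {p : (EuclideanSpace ℝ (Fin n) × EuclideanSpace ℝ (Fin n)) ×
      EuclideanSpace ℝ (Fin n) | p.2 ∈ E ∧ p.2 - p.1.1 ∈ B ∩ {z | z - p.1.2 ∉ B}} :=
    (measurable_snd hE).inter
      (((measurable_snd.sub (measurable_fst.comp measurable_fst)) hB).inter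
      (((measurable_snd.sub (measurable_fst.comp measurable_fst)).sub
        (measurable_snd.comp measurable_fst)) hB.compl))
  exact measurable_measure_prodMk_left hm

theorem lintegral_lintegral_mul_le {X Y : Type*} [MeasurableSpace X] [MeasurableSpace Y]
    {μ : Measure X} {ν : Measure Y} [SFinite μ] [SFinite ν] {k α β : Y → ENNReal}
    {T a b : X → Y → ENNReal} {c d : ENNReal} (hk : Measurable k) (hα : Measurable α)
    (hβ : Measurable β) (ha : Measurable fun p : X × Y => a p.1 p.2)
    (hb : Measurable fun p : X × Y => b p.1 p.2) (hT : ∀ x y, T x y ≤ a x y + b x y)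
    (hinta : ∀ y, ∫⁻ x, a x y ∂μ = c * α y) (hintb : ∀ y, ∫⁻ x, b x y ∂μ = β y * d) :
    ∫⁻ x, ∫⁻ y, k y * T x y ∂ν ∂μ ≤ c * ∫⁻ y, k y * α y ∂ν + d * ∫⁻ y, k y * β y ∂ν := by
  have h1 : Measurable fun y => k y * α y := hk.mul hα
  have h2 : Measurable fun y => k y * β y := hk.mul hβ
  calc ∫⁻ x, ∫⁻ y, k y * T x y ∂ν ∂μ
      ≤ ∫⁻ x, ∫⁻ y, k y * (a x y + b x y) ∂ν ∂μ :=
        lintegral_mono fun x => lintegral_mono fun y => mul_le_mul_right (hT x y) _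
    _ = ∫⁻ y, ∫⁻ x, k y * (a x y + b x y) ∂μ ∂ν :=
        lintegral_lintegral_swap ((hk.comp measurable_snd).mul (ha.add hb)).aemeasurable
    _ = ∫⁻ y, (c * (k y * α y) + d * (k y * β y)) ∂ν := by
        refine lintegral_congr fun y => ?_
        have hay : Measurable fun x => a x y := ha.comp measurable_prodMk_right
        have hby : Measurable fun x => b x y := hb.comp measurable_prodMk_right
        have hab : Measurable fun x => a x y + b x y := hay.add hby
        rw [lintegral_const_mul _ hab, lintegral_add_left hay, hinta, hintb]
        ring
    _ = _ := by
        rw [lintegral_add_left (h1.const_mul _), lintegral_const_mul _ h1,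
          lintegral_const_mul _ h2]

/-- A shift leaves `E ∩ (x + B)` by leaving `E` or by leaving `x + B`. Integrating each alternative
over `x` factors it into a product of measures. -/
theorem lintegral_sPerimeter_inter_translate_le (s : ℝ) {E B : Set (EuclideanSpace ℝ (Fin n))}
    (hE : MeasurableSet E) (hB : MeasurableSet B) :
    ∫⁻ x, sPerimeter s (E ∩ {y | y - x ∈ B}) ≤
      volume B * sPerimeter s E +
        volume E * ∫⁻ h, perimeterKernel n s h * translateDiff B h := by
  have hmE : ∀ h, MeasurableSet {y | y - h ∉ E} := fun h => (measurable_id.sub_const h) hE.compl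
  have hmB : ∀ h, MeasurableSet {y | y - h ∉ B} := fun h => (measurable_id.sub_const h) hB.compl
  have hx : ∀ x, MeasurableSet {y | y - x ∈ B} := fun x => (measurable_id.sub_const x) hB
  have hinta : ∀ h, ∫⁻ x, volume {y | y ∈ E ∩ {y | y - h ∉ E} ∧ y - x ∈ B} =
      volume B * translateDiff E h := fun h =>
    lintegral_volume_inter_sub_mem (hE.inter (hmE h)) hB
  have hintb : ∀ h, ∫⁻ x, volume {y | y ∈ E ∧ y - x ∈ B ∩ {z | z - h ∉ B}} =
      translateDiff B h * volume E := fun h =>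
    lintegral_volume_inter_sub_mem hE (hB.inter (hmB h))
  rw [sPerimeter_eq_lintegral_translateDiff s hE]
  simp_rw [fun x => sPerimeter_eq_lintegral_translateDiff s (hE.inter (hx x))]
  exact lintegral_lintegral_mul_le (measurable_perimeterKernel s) (measurable_translateDiff hE)
    (measurable_translateDiff hB) (measurable_volume_mem_inter_and_sub_mem hE hB)
    (measurable_volume_mem_and_sub_mem_inter hE hB) (translateDiff_inter_translate_le E B)
    hinta hintb

theorem lintegral_sPerimeter_inter_ball_le (s r : ℝ) {E : Set (EuclideanSpace ℝ (Fin n))}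
    (hE : MeasurableSet E) :
    ∫⁻ x, sPerimeter s (E ∩ Metric.ball x r) ≤
      volume (Metric.ball (0 : EuclideanSpace ℝ (Fin n)) r) * sPerimeter s E +
        volume E * ∫⁻ h, perimeterKernel n s h * translateDiff (Metric.ball 0 r) h := by
  refine le_trans (le_of_eq ?_) (lintegral_sPerimeter_inter_translate_le s hE measurableSet_ball)
  refine lintegral_congr fun x => ?_
  congr 2
  ext y
  rw [mem_ofPred_eq, mem_ball_iff_norm, mem_ball_zero_iff]

theorem exists_volume_eq_ballVolume_mul_pow (hn : 2 ≤ n) {v : ℝ} (hv : 0 < v) :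
    ∃ R : ℝ, 0 < R ∧ v = ballVolume n * R ^ n ∧
      ∀ s : ℝ, R ^ s = (v / ballVolume n) ^ (s / n) := by
  have hw := ballVolume_pos (n := n)
  refine ⟨(v / ballVolume n) ^ (1 / (n : ℝ)), by positivity, ?_, fun s => ?_⟩
  · rw [← Real.rpow_natCast, ← Real.rpow_mul (by positivity), one_div_mul_cancel
      (by positivity), Real.rpow_one]
    field_simp
  · rw [← Real.rpow_mul (by positivity), one_div_mul_eq_div]

/-- Linear form of the isoperimetric inequality: the volume bound amounts to `R^s ≤ m / |B|^(s/n)`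
for the radius `R` of the ball with the volume of `F`. -/
theorem le_sPerimeter_of_volume_le (hn : 2 ≤ n) {s m : ℝ} (hs : 0 < s) (hs1 : s < 1) (hm : 0 < m)
    {F : Set (EuclideanSpace ℝ (Fin n))} (hF : MeasurableSet F)
    (hv : volume F ≤ ENNReal.ofReal (m ^ ((n : ℝ) / s))) :
    ENNReal.ofReal (5 / 16 * (n * ballVolume n * 2 ^ (-s) / (s * (1 - s))) *
      (ballVolume n ^ (s / n) / m)) * volume F ≤ sPerimeter s F := by
  have hw := ballVolume_pos (n := n)
  have h1s := sub_pos.2 hs1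
  have hn0 : (0 : ℝ) < n := by positivity
  rcases eq_or_ne (volume F) 0 with h0 | h0
  · simp [h0]
  have hfin : volume F ≠ ⊤ := ne_top_of_le_ne_top ENNReal.ofReal_ne_top hv
  have hv0 := ENNReal.toReal_pos h0 hfin
  obtain ⟨R, hR, hvR, hRs⟩ := exists_volume_eq_ballVolume_mul_pow hn hv0
  have hvF : volume F = ENNReal.ofReal (ballVolume n * R ^ n) := by
    rw [← hvR, ENNReal.ofReal_toReal hfin]
  refine le_trans ?_ (le_sPerimeter_of_volume_eq hn hs hs1 hR hF hvF)
  rw [hvF, ← ENNReal.ofReal_mul (by positivity)]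
  refine ENNReal.ofReal_le_ofReal ?_
  gcongr ?_ * _
  have hvm : (volume F).toReal ≤ m ^ ((n : ℝ) / s) :=
    ENNReal.toReal_le_of_le_ofReal (by positivity) hv
  have hRm : R ^ s ≤ m / ballVolume n ^ (s / n) := by
    rw [hRs, Real.div_rpow hv0.le hw.le]
    gcongr
    calc _ ≤ (m ^ ((n : ℝ) / s)) ^ (s / n) := by gcongr
      _ = m := by
        rw [← Real.rpow_mul hm.le, div_mul_div_cancel₀ hs.ne', div_self hn0.ne', Real.rpow_one]
  have hRm' : ballVolume n ^ (s / n) / m ≤ R ^ (-s) := by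
    rw [Real.rpow_neg hR.le, ← inv_div]
    gcongr
  rw [Real.mul_rpow (by norm_num) hR.le]
  calc _ ≤ 5 / 16 * (n * ballVolume n * 2 ^ (-s) / (s * (1 - s))) * R ^ (-s) := by gcongr
    _ = _ := by ring

theorem mul_toReal_volume_le_of_volume_inter_ball_le (hn : 2 ≤ n) {s m : ℝ} (hs : 0 < s)
    (hs1 : s < 1) (hm : 0 < m) {E : Set (EuclideanSpace ℝ (Fin n))} (hE : MeasurableSet E)
    (hP : sPerimeter s E ≠ ⊤) (hfin : volume E ≠ ⊤)
    (hv : ∀ x, volume (E ∩ Metric.ball x (1 / 2)) ≤ ENNReal.ofReal (m ^ ((n : ℝ) / s))) :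
    5 / 16 * (n * ballVolume n * 2 ^ (-s) / (s * (1 - s))) * (ballVolume n ^ (s / n) / m) *
        (volume E).toReal ≤
      (sPerimeter s E).toReal +
        (volume E).toReal * (n * ballVolume n * (n : ℝ) ^ s / (s * (1 - s))) := by
  have hw := ballVolume_pos (n := n)
  have h1s := sub_pos.2 hs1
  have hn0 : (0 : ℝ) < n := by positivity
  have h12 : (0 : ℝ) < 1 / 2 := by norm_num
  set K := 5 / 16 * (n * ballVolume n * 2 ^ (-s) / (s * (1 - s))) * (ballVolume n ^ (s / n) / m)
  have hK : 0 < K := by positivity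
  have hint : ∫⁻ x, volume (E ∩ Metric.ball x (1 / 2)) =
      volume (Metric.ball (0 : EuclideanSpace ℝ (Fin n)) (1 / 2)) * volume E := by
    rw [← lintegral_volume_inter_sub_mem hE measurableSet_ball]
    congr! with x
    ext y
    show _ ∧ _ ↔ _ ∧ _
    rw [mem_ball_iff_norm, mem_ball_zero_iff]
  have h1 : ENNReal.ofReal K * (volume (Metric.ball (0 : EuclideanSpace ℝ (Fin n)) (1 / 2)) *
      volume E) ≤ ∫⁻ x, sPerimeter s (E ∩ Metric.ball x (1 / 2)) := by
    rw [← hint, ← lintegral_const_mul' _ _ ENNReal.ofReal_ne_top]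
    exact lintegral_mono fun x =>
      le_sPerimeter_of_volume_le hn hs hs1 hm (hE.inter measurableSet_ball) (hv x)
  have h2 := h1.trans (lintegral_sPerimeter_inter_ball_le s (1 / 2) hE)
  have h3 := h2.trans (add_le_add le_rfl
    (mul_le_mul_right (lintegral_translateDiff_ball_le hn hs hs1 h12) _))
  rw [volume_ball_eq hn _ h12.le, ← ENNReal.ofReal_toReal hP, ← ENNReal.ofReal_toReal hfin,
    ← ENNReal.ofReal_mul (by positivity), ← ENNReal.ofReal_mul (by positivity),
    ← ENNReal.ofReal_mul (by positivity), ← ENNReal.ofReal_mul (by positivity),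
    ← ENNReal.ofReal_add (by positivity) (by positivity),
    ENNReal.ofReal_le_ofReal_iff (by positivity)] at h3
  rw [show (2 : ℝ) * (1 / 2) / n = (n : ℝ)⁻¹ by norm_num, Real.inv_rpow hn0.le,
    Real.rpow_neg hn0.le, inv_inv] at h3
  have hc : 0 < ballVolume n * (1 / 2) ^ n := by positivity
  refine le_of_mul_le_mul_left (le_trans (le_of_eq ?_) (h3.trans (le_of_eq ?_))) hc <;> ring

/-! ### Density points and null sets -/

theorem exists_mem_densityOnePoints {E S : Set (EuclideanSpace ℝ (Fin n))} (hn : 2 ≤ n)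
    (h : volume (E ∩ S) ≠ 0) : ∃ z ∈ densityOnePoints E, z ∈ S := by
  have : Nonempty (Fin n) := ⟨⟨0, by omega⟩⟩
  by_contra! hcon
  refine h ?_
  have hae := Besicovitch.ae_tendsto_measure_inter_div (volume : Measure (EuclideanSpace ℝ (Fin n))) E
  have hsub : ∀ᵐ x ∂volume.restrict E, x ∉ S := by
    filter_upwards [hae] with x hx
    refine hcon x (hx.congr' ?_)
    -- The density theorem is stated for closed balls; spheres are null.
    filter_upwards [self_mem_nhdsWithin] with r hr
    rw [Measure.addHaar_closedBall_eq_addHaar_ball]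
    congr 1
    refine measure_congr ((ae_eq_refl E).inter ?_)
    refine (Metric.ball_subset_closedBall.eventuallyLE.antisymm ?_).symm
    rw [ae_le_set, Metric.closedBall_sdiff_ball]
    exact Measure.addHaar_sphere _ _ _
  have h0 := measure_mono_null (fun x hx => not_not.2 hx : S ⊆ {x | ¬ x ∉ S}) hsub
  refine le_antisymm ?_ zero_le
  rw [inter_comm, ← h0]
  exact Measure.le_restrict_apply _ _

/-- Allows a null-measurable `E` to be replaced by a measurable hull. -/
theorem sPerimeter_congr (s : ℝ) {E F : Set (EuclideanSpace ℝ (Fin n))} (h : E =ᵐ[volume] F) :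
    sPerimeter s E = sPerimeter s F := by
  unfold sPerimeter
  rw [Measure.restrict_congr_set h, Measure.restrict_congr_set h.compl]

/-! ### Explicit bounds for `χ₁` and `χ₂` -/

/-- Equality holds at `n = 3`. -/
theorem sq_le_nine_eighths_mul_two_pow (hn : 2 ≤ n) : (n : ℝ) ^ 2 ≤ 9 / 8 * 2 ^ n := by
  suffices h : 8 * n ^ 2 ≤ 9 * 2 ^ n by
    have : (8 * n ^ 2 : ℝ) ≤ 9 * 2 ^ n := by exact_mod_cast h
    linarith
  induction n, hn using Nat.le_induction with
  | base => norm_num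
  | succ k hk ih =>
    rcases Nat.lt_or_ge k 3 with h | h
    · interval_cases k
      norm_num
    · rw [pow_succ 2 k]
      nlinarith

theorem toReal_sPerimeter_unitBall_bounds (hn : 2 ≤ n) {s : ℝ} (hs : 0 < s) (hs1 : s < 1) :
    5 / 16 * (n * ballVolume n ^ 2 * 2 ^ (-s) / (s * (1 - s))) ≤
        (sPerimeter s (unitBall n)).toReal ∧
      (sPerimeter s (unitBall n)).toReal ≤
        n * ballVolume n ^ 2 * ((n : ℝ) / 2) ^ s / (s * (1 - s)) := by
  have hw := ballVolume_pos (n := n)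
  have h1s := sub_pos.2 hs1
  have hn0 : (0 : ℝ) < n := by positivity
  have hup := lintegral_translateDiff_ball_le hn hs hs1 one_pos
  rw [← sPerimeter_eq_lintegral_translateDiff s measurableSet_ball] at hup
  have hlow := le_sPerimeter_of_volume_eq hn hs hs1 one_pos
    (measurableSet_ball : MeasurableSet (unitBall n)) 
    (by rw [one_pow, mul_one]; exact volume_unitBall)
  have hfin : sPerimeter s (unitBall n) ≠ ⊤ := ne_top_of_le_ne_top ENNReal.ofReal_ne_top hup
  constructor
  · refine le_trans (le_of_eq ?_) ((ENNReal.ofReal_le_iff_le_toReal hfin).1 hlow)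
    rw [one_pow, mul_one, mul_one]
    ring
  · refine (ENNReal.toReal_le_of_le_ofReal (by positivity) hup).trans (le_of_eq ?_)
    rw [mul_one, one_pow, mul_one, Real.rpow_neg (by positivity), ← Real.inv_rpow (by positivity),
      inv_div]

theorem toReal_perimeter_unitBall_bound (hn : 2 ≤ n) :
    4 / 5 * (n * ballVolume n) ≤ (perimeter (unitBall n)).toReal :=
  (ENNReal.ofReal_le_iff_le_toReal (perimeter_unitBall_lt_top hn).ne).1 (le_perimeter_unitBall n)

theorem one_div_chi₂ (n : ℕ) (s : ℝ) :
    1 / chi₂ n s = s * (1 - s) * (sPerimeter s (unitBall n)).toReal /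
      ((2 : ℝ) ^ (3 + (n : ℝ) / s) * ballVolume n ^ (((n : ℝ) - s) / n) *
        (perimeter (unitBall n)).toReal) := by
  rw [chi₂, one_div_div]
  rfl

theorem chi₁_eq (n : ℕ) (s : ℝ) :
    chi₁ n s = (1 - s) * (sPerimeter s (unitBall n)).toReal /
      (4 * ballVolume n ^ (((n : ℝ) - s) / n) * besicovitchConst n) := rfl

theorem sPerimeter_unitBall_pos (hn : 2 ≤ n) {s : ℝ} (hs : 0 < s) (hs1 : s < 1) :
    0 < (sPerimeter s (unitBall n)).toReal := by
  have hw := ballVolume_pos (n := n)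
  have h1s := sub_pos.2 hs1
  exact lt_of_lt_of_le (by positivity) (toReal_sPerimeter_unitBall_bounds hn hs hs1).1

theorem perimeter_unitBall_pos (hn : 2 ≤ n) : 0 < (perimeter (unitBall n)).toReal := by
  have hw := ballVolume_pos (n := n)
  exact lt_of_lt_of_le (by positivity) (toReal_perimeter_unitBall_bound hn)

theorem besicovitchConst_pos (hn : 2 ≤ n) : (0 : ℝ) < besicovitchConst n := by
  have := two_mul_le_besicovitchConst n
  exact_mod_cast (show 0 < besicovitchConst n by omega)

theorem ballVolume_rpow_sub_div (hn : 2 ≤ n) (s : ℝ) :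
    ballVolume n ^ (((n : ℝ) - s) / n) = ballVolume n / ballVolume n ^ (s / n) := by
  have hn0 : (n : ℝ) ≠ 0 := by positivity
  rw [sub_div, div_self hn0, Real.rpow_sub ballVolume_pos, Real.rpow_one]

theorem chi₁_div_le (hn : 2 ≤ n) {s : ℝ} (hs : 0 < s) (hs1 : s < 1) :
    chi₁ n s / (1 - s) ≤
      ballVolume n ^ (s / n) * (n * ballVolume n / (s * (1 - s))) * (((n : ℝ) / 2) ^ s / (8 * n)) := by
  have hw := ballVolume_pos (n := n)
  have h1s := sub_pos.2 hs1
  have hn0 : (0 : ℝ) < n := by positivity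
  have hξ : (2 * n : ℝ) ≤ besicovitchConst n := by exact_mod_cast two_mul_le_besicovitchConst n
  have hp := (toReal_sPerimeter_unitBall_bounds hn hs hs1).2
  rw [chi₁_eq, ballVolume_rpow_sub_div hn]
  calc _ ≤ (1 - s) * (n * ballVolume n ^ 2 * ((n : ℝ) / 2) ^ s / (s * (1 - s))) /
      (4 * (ballVolume n / ballVolume n ^ (s / n)) * (2 * n)) / (1 - s) := by gcongr
    _ = _ := by
      field_simp
      ring

theorem one_div_chi₂_le (hn : 2 ≤ n) {s : ℝ} (hs : 0 < s) (hs1 : s < 1) :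
    1 / chi₂ n s ≤
      ballVolume n ^ (s / n) * (5 / 32 * ((n : ℝ) / 2) ^ s / 2 ^ ((n : ℝ) / s)) := by
  have hw := ballVolume_pos (n := n)
  have h1s := sub_pos.2 hs1
  have hn0 : (0 : ℝ) < n := by positivity
  have hp := (toReal_sPerimeter_unitBall_bounds hn hs hs1).2
  have hq := toReal_perimeter_unitBall_bound hn
  rw [one_div_chi₂, ballVolume_rpow_sub_div hn, Real.rpow_add (by norm_num)]
  calc _ ≤ s * (1 - s) * (n * ballVolume n ^ 2 * ((n : ℝ) / 2) ^ s / (s * (1 - s))) /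
      (2 ^ (3 : ℝ) * 2 ^ ((n : ℝ) / s) * (ballVolume n / ballVolume n ^ (s / n)) *
        (4 / 5 * (n * ballVolume n))) := by gcongr
    _ = _ := by
      rw [show (2 : ℝ) ^ (3 : ℝ) = 8 by norm_num]
      field_simp
      ring

/-- The numerical contradiction. After the common factor `2^(-s)` is removed, the left side is at
most `1/8 + 45/256 = 77/256`, against `5/16 = 80/256`. -/
theorem chi_constants_lt (hn : 2 ≤ n) {s : ℝ} (hs : 0 < s) (hs1 : s < 1) :
    ((n : ℝ) / 2) ^ s / (8 * n) +
      (n : ℝ) ^ s * (5 / 32 * ((n : ℝ) / 2) ^ s / 2 ^ ((n : ℝ) / s)) < 5 / 16 * 2 ^ (-s) := by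
  have hn0 : (0 : ℝ) < n := by positivity
  have hn1 : (1 : ℝ) ≤ n := by exact_mod_cast (show 1 ≤ n by omega)
  have hns : (n : ℝ) ^ s ≤ n := by
    simpa using Real.rpow_le_rpow_of_exponent_le hn1 hs1.le
  have h2 : (2 : ℝ) ^ n ≤ 2 ^ ((n : ℝ) / s) := by
    rw [← Real.rpow_natCast]
    refine Real.rpow_le_rpow_of_exponent_le (by norm_num) ?_
    rw [le_div_iff₀ hs]
    nlinarith
  have h9 := sq_le_nine_eighths_mul_two_pow hn
  have e1 : (n : ℝ) ^ s / (8 * n) ≤ 1 / 8 := by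
    rw [div_le_div_iff₀ (by positivity) (by norm_num)]
    linarith
  have e2 : (n : ℝ) ^ s * (5 / 32 * (n : ℝ) ^ s / 2 ^ ((n : ℝ) / s)) ≤ 45 / 256 := by
    rw [← mul_div_assoc, div_le_iff₀ (by positivity)]
    have : (n : ℝ) ^ s * n ^ s ≤ n ^ 2 := by
      rw [sq]
      gcongr
    nlinarith
  rw [Real.div_rpow hn0.le (by norm_num), Real.rpow_neg (by norm_num)]
  calc _ = ((n : ℝ) ^ s / (8 * n) + (n : ℝ) ^ s * (5 / 32 * (n : ℝ) ^ s / 2 ^ ((n : ℝ) / s))) *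
        ((2 : ℝ) ^ s)⁻¹ := by
        field_simp
    _ < _ := by
        gcongr
        linarith

/-! ### The contradiction argument and uniformity in `s` -/

theorem exists_densityOnePoint_volume_inter_ball_ge (hn : 2 ≤ n) {s : ℝ} (hs : 0 < s) (hs1 : s < 1)
    {E : Set (EuclideanSpace ℝ (Fin n))} (hE : NullMeasurableSet E volume)
    (hP : sPerimeter s E < ⊤) (hE0 : 0 < volume E) (hfin : volume E < ⊤) :
    ∃ x ∈ densityOnePoints E,
      (volume (E ∩ Metric.ball x 1)).toReal ≥
        (min (chi₁ n s * (volume E).toReal / ((1 - s) * (sPerimeter s E).toReal))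
          (1 / chi₂ n s)) ^ ((n : ℝ) / s) := by
  have hw := ballVolume_pos (n := n)
  have h1s := sub_pos.2 hs1
  have hn0 : (0 : ℝ) < n := by positivity
  obtain ⟨F, -, hF, hFE⟩ := hE.exists_measurable_superset_ae_eq
  have he := ENNReal.toReal_pos hE0.ne' hfin.ne
  -- Positivity, from the isoperimetric inequality, keeps the quotient in `m` from degenerating to a
  -- division by zero.
  have hPpos : 0 < (sPerimeter s E).toReal := by
    obtain ⟨R, hR, hvR, -⟩ := exists_volume_eq_ballVolume_mul_pow hn he
    have hv : volume F = ENNReal.ofReal (ballVolume n * R ^ n) := by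
      rw [← hvR, ENNReal.ofReal_toReal hfin.ne, measure_congr hFE]
    have h := le_sPerimeter_of_volume_eq hn hs hs1 hR hF hv
    rw [sPerimeter_congr s hFE, ENNReal.ofReal_le_iff_le_toReal hP.ne] at h
    exact lt_of_lt_of_le (by positivity) h
  have hp := sPerimeter_unitBall_pos hn hs hs1
  have hq := perimeter_unitBall_pos hn
  have hξ := besicovitchConst_pos hn
  set m := min (chi₁ n s * (volume E).toReal / ((1 - s) * (sPerimeter s E).toReal)) (1 / chi₂ n s)
  have hm : 0 < m := by
    refine lt_min ?_ ?_
    · rw [chi₁_eq]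
      positivity
    · rw [one_div_chi₂]
      positivity
  by_contra! hcon
  have hsmall : ∀ x, volume (F ∩ Metric.ball x (1 / 2)) ≤ ENNReal.ofReal (m ^ ((n : ℝ) / s)) := by
    intro x
    rw [measure_congr (hFE.inter (ae_eq_refl (Metric.ball x (1 / 2))))]
    rcases eq_or_ne (volume (E ∩ Metric.ball x (1 / 2))) 0 with h0 | h0
    · rw [h0]
      exact zero_le
    · obtain ⟨z, hz, hzx⟩ := exists_mem_densityOnePoints hn h0
      have hsub : Metric.ball x (1 / 2) ⊆ Metric.ball z 1 := by
        refine Metric.ball_subset_ball' ?_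
        rw [dist_comm]
        rw [Metric.mem_ball] at hzx
        linarith
      refine (measure_mono (inter_subset_inter_right E hsub)).trans ?_
      rw [← ENNReal.ofReal_toReal (measure_ne_top_of_subset inter_subset_left hfin.ne)]
      exact ENNReal.ofReal_le_ofReal (hcon z hz).le
  have hmain := mul_toReal_volume_le_of_volume_inter_ball_le hn hs hs1 hm hF
    (by rw [sPerimeter_congr s hFE]; exact hP.ne) (by rw [measure_congr hFE]; exact hfin.ne) hsmall
  rw [sPerimeter_congr s hFE, measure_congr hFE] at hmain
  have hm1 : m * (sPerimeter s E).toReal ≤ chi₁ n s / (1 - s) * (volume E).toReal := by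
    have := min_le_left (chi₁ n s * (volume E).toReal / ((1 - s) * (sPerimeter s E).toReal))
      (1 / chi₂ n s)
    calc _ ≤ chi₁ n s * (volume E).toReal / ((1 - s) * (sPerimeter s E).toReal) *
          (sPerimeter s E).toReal := by gcongr
      _ = _ := by field_simp
  have hm2 := (min_le_right _ _ : m ≤ 1 / chi₂ n s).trans (one_div_chi₂_le hn hs hs1)
  have hc1 := chi₁_div_le hn hs hs1
  set e := (volume E).toReal
  set P := (sPerimeter s E).toReal
  set w := ballVolume n
  set D := n * w / (s * (1 - s))
  have hD : 0 < D := by positivity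
  set α := ((n : ℝ) / 2) ^ s / (8 * n)
  set β := 5 / 32 * ((n : ℝ) / 2) ^ s / 2 ^ ((n : ℝ) / s)
  have hconst : α + n ^ s * β < 5 / 16 * 2 ^ (-s) := chi_constants_lt hn hs hs1
  -- The averaged inequality times `m`. Next, `χ₁` bounds `m * P` (giving `α`) and `χ₂` bounds the
  -- remaining `m` (giving `β`).
  have h1 : w ^ (s / n) * D * e * (5 / 16 * 2 ^ (-s)) ≤ m * P + m * (e * (D * n ^ s)) := by
    calc _ = m * (5 / 16 * (n * w * 2 ^ (-s) / (s * (1 - s))) * (w ^ (s / n) / m) * e) := by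
          simp only [D]
          field_simp
      _ ≤ m * (P + e * (n * w * n ^ s / (s * (1 - s)))) := by gcongr
      _ = _ := by
          simp only [D]
          ring
  have h2 : m * P + m * (e * (D * n ^ s)) ≤ w ^ (s / n) * D * e * (α + n ^ s * β) := by
    calc _ ≤ w ^ (s / n) * D * α * e + w ^ (s / n) * β * (e * (D * n ^ s)) := by
          refine add_le_add (hm1.trans ?_) ?_
          · gcongr
          · gcongr
      _ = _ := by ring
  have h3 := le_of_mul_le_mul_left (h1.trans h2) (by positivity)
  linarith

theorem exists_pos_le_chi (hn : 2 ≤ n) {s₀ : ℝ} (hs₀ : 0 < s₀) :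
    ∃ c : ℝ, 0 < c ∧ ∀ s ∈ Ico s₀ 1, c ≤ chi₁ n s ∧ c ≤ (chi₂ n s)⁻¹ := by
  have hw := ballVolume_pos (n := n)
  have hn0 : (0 : ℝ) < n := by positivity
  have hq := perimeter_unitBall_pos hn
  have hξ := besicovitchConst_pos hn
  set w := ballVolume n
  -- A lower bound for `(1-s) P_s(B)` uniform in `s`, from `2^(-s) ≥ 1/2` and `s ≤ 1`.
  set q := 5 / 32 * (n * w ^ 2)
  have hq0 : 0 < q := by positivity
  have hM : 0 < max 1 w := lt_max_of_lt_left one_pos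
  refine ⟨min (q / (4 * max 1 w * besicovitchConst n))
    (s₀ * q / (2 ^ (3 + (n : ℝ) / s₀) * max 1 w * (perimeter (unitBall n)).toReal)),
    lt_min (by positivity) (by positivity), fun s hs => ?_⟩
  have hs0 : 0 < s := hs₀.trans_le hs.1
  have hs1 := hs.2
  have h1s := sub_pos.2 hs1
  -- The exponent lies in `[0,1]`; `max 1 w` covers both `w ≤ 1` and `w > 1`.
  have hwM : w ^ (((n : ℝ) - s) / n) ≤ max 1 w := by
    have hn2 : (2 : ℝ) ≤ n := by exact_mod_cast hn
    have hexp0 : 0 ≤ ((n : ℝ) - s) / n := div_nonneg (by linarith) hn0.le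
    have hexp1 : ((n : ℝ) - s) / n ≤ 1 := by
      rw [div_le_one hn0]
      linarith
    calc _ ≤ (max 1 w) ^ (((n : ℝ) - s) / n) := by
          gcongr
          exact le_max_right _ _
      _ ≤ (max 1 w) ^ (1 : ℝ) := Real.rpow_le_rpow_of_exponent_le (le_max_left _ _) hexp1
      _ = _ := Real.rpow_one _
  have hp : q ≤ (1 - s) * (sPerimeter s (unitBall n)).toReal := by
    have h := (toReal_sPerimeter_unitBall_bounds hn hs0 hs1).1
    have h2 : (1 / 2 : ℝ) ≤ 2 ^ (-s) := by
      rw [show (1 / 2 : ℝ) = 2 ^ (-1 : ℝ) by rw [Real.rpow_neg_one]; norm_num]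
      exact Real.rpow_le_rpow_of_exponent_le (by norm_num) (by linarith)
    calc q = 5 / 16 * (n * w ^ 2 * (1 / 2) / 1) := by simp only [q]; ring
      _ ≤ 5 / 16 * (n * w ^ 2 * 2 ^ (-s) / s) := by gcongr
      _ = (1 - s) * (5 / 16 * (n * w ^ 2 * 2 ^ (-s) / (s * (1 - s)))) := by field_simp
      _ ≤ _ := by gcongr
  constructor
  · refine (min_le_left _ _).trans ?_
    rw [chi₁_eq]
    gcongr
  · refine (min_le_right _ _).trans ?_
    rw [← one_div, one_div_chi₂, mul_assoc s]
    gcongr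
    exacts [hs.1, by norm_num, hs.1]

end

theorem mainTheorem11 (n : ℕ) (hn : 2 ≤ n) :
    (∀ s : ℝ, 0 < s → s < 1 →
      ∀ E : Set (EuclideanSpace ℝ (Fin n)), NullMeasurableSet E volume →
        sPerimeter s E < ⊤ → 0 < volume E → volume E < ⊤ →
        ∃ x ∈ densityOnePoints E,
          (volume (E ∩ Metric.ball x 1)).toReal ≥
            (min (chi₁ n s * (volume E).toReal / ((1 - s) * (sPerimeter s E).toReal))
              (1 / chi₂ n s)) ^ ((n : ℝ) / s)) ∧
    (∀ s₀ : ℝ, 0 < s₀ → s₀ < 1 →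
      0 < sInf {t : EReal | ∃ s ∈ Set.Ico s₀ 1,
          t = ((chi₁ n s : ℝ) : EReal) ∨ t = (((chi₂ n s)⁻¹ : ℝ) : EReal)} ∧
      sInf {t : EReal | ∃ s ∈ Set.Ico s₀ 1,
          t = ((chi₁ n s : ℝ) : EReal) ∨ t = (((chi₂ n s)⁻¹ : ℝ) : EReal)} < ⊤) := by
  refine ⟨fun s hs hs1 E hE hP hE0 hfin =>
    exists_densityOnePoint_volume_inter_ball_ge hn hs hs1 hE hP hE0 hfin, fun s₀ hs₀ hs₀1 => ?_⟩
  obtain ⟨c, hc, hle⟩ := exists_pos_le_chi hn hs₀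
  constructor
  · refine lt_of_lt_of_le (EReal.coe_pos.2 hc) (le_sInf ?_)
    rintro t ⟨s, hs, rfl | rfl⟩
    · exact EReal.coe_le_coe_iff.2 (hle s hs).1
    · exact EReal.coe_le_coe_iff.2 (hle s hs).2
  · refine lt_of_le_of_lt (sInf_le ?_) (EReal.coe_lt_top (chi₁ n s₀))
    exact ⟨s₀, ⟨le_rfl, hs₀1⟩, Or.inl rfl⟩
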